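/- Let $A=\overline{\bigcup_{n\in\mathbb N}A_n}^{\|\cdot\|_A}$ be a unital AF-algebra, where $A_0=\mathbb C1_A\subseteq A_1\subseteq A_2\subseteq\cdots$ are finite-dimensional C*-subalgebras containing $1_A$ ($\mathbb N$ starts at $0$), equipped with a faithful tracial state $\tau$. For each $n$ let $E_n:A\to A_n$ be the unique $\tau$-preserving conditional expectation onto $A_n$. Let $(\beta(n))_{n\in\mathbb N}$ be a sequence in $(0,\infty)$ with $\beta(n)\to0$ and $\beta(n)/\beta(n-1)\to 0$, and put $$L_\beta(a)=\sup_{n\in\mathbb N}\frac{\|a-E_n(a)\|_A}{\beta(n)}\qquad(a\in A),$$ an L-seminorm when restricted to self-adjoint elements. Let $I$ be a norm-closed two-sided ideal of $A$, let $I_n=I\cap A_n$, and let $1_n$ be the unit of the finite-dimensional algebra $I_n$; $(1_n)_n$ is an approximate identity of $I$. For $\omega\in I$ define $$D_I(\omega)=\max\Big\{L_\beta(\omega),\ \|\omega\|_A,\ \sup_{n\in\mathbb N}\frac{\|\omega-\omega1_n\|_A}{\beta(n)}\Big\},$$ let $D_{I_n}$ be the restriction of $D_I$ to $I_n$, and let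 $\langle\omega,\nu\rangle_I=\omega\nu^*$ on $I$, with restriction $\langle\cdot,\cdot\rangle_{I_n}$ to $I_n$. For $x_1,\dots,x_4,x,y,z\ge0$ let $$F(x_1,x_2,x_3,x_4)=2(x_1x_4+x_2x_3),\quad G(x,y,z)=F(x,y,z,z),\quad H(x,y)=F(x,x,y,y).$$ Then $(F,G,H)$ is an admissible triple, and $$\Omega^\beta_I=(I,\langle\cdot,\cdot\rangle_I,D_I,A,L_\beta)\quad\text{and}\quad \Omega^\beta_{I_n}=(I_n,\langle\cdot,\cdot\rangle_{I_n},D_{I_n},A_n,L_\beta)\ (n\in\mathbb N)$$ are $(F,G,H)$-metrized quantum vector bundles in the sense of Latrémolière. Moreover $$\lim_{n\to\infty}\Lambda^{mod}(\Omega^\beta_{I_n},\Omega^\beta_I)=0,$$ where $\Lambda^{mod}$ is Latrémolière's modular Gromov–Hausdorff propinquity. More precisely, for $n\ge1$ put $$x_n=\max\Big\{1+\beta(n),\ \max_{m<n}\frac{2\beta(n)+\beta(m)}{\beta(m)}\Big\}.$$ Then $\max\{\beta(n),x_n-1\}\to0$ as $n\to\infty$, and $$\Lambda^{mod}(\Omega^\beta_{I_n},\Omega^\beta_I)\le\max\{\beta(n),x_n-1\}$$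 for every $n\ge1$ such that $\beta(n)\ge 1$ or $\beta(m)\le1$ for some $m<n$; that is, for every $n\geq 1$ if $\beta(0)\le1$, and for every $n\ge1$ with at most one exception, namely the first $n$ with $\beta(n)<1$, if $\beta(0)>1$. For every $n\ge1$ without exception, $$\Lambda^{mod}(\Omega^\beta_{I_n},\Omega^\beta_I)\le\max\{\beta(n),x_n-1\}+\beta(n)^2 .$$ -/

import Mathlib

open Filter Topology
open scoped NNReal ENNReal ComplexOrder ComplexStarModule

universe u

noncomputable section

namespace ModularPropinquity

/-! ### Admissible functions -/

/-- Admissible functions `F : [0,∞)⁴ → [0,∞)`. -/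
structure IsAdmissible (F : ℝ≥0 → ℝ≥0 → ℝ≥0 → ℝ≥0 → ℝ≥0) : Prop where
  mono : ∀ x₁ x₂ x₃ x₄ y₁ y₂ y₃ y₄, x₁ ≤ y₁ → x₂ ≤ y₂ → x₃ ≤ y₃ → x₄ ≤ y₄ →
    F x₁ x₂ x₃ x₄ ≤ F y₁ y₂ y₃ y₄
  leibniz_le : ∀ x₁ x₂ x₃ x₄, x₁ * x₄ + x₂ * x₃ ≤ F x₁ x₂ x₃ x₄

/-- Admissible triples `(F, G, H)`. -/
structure IsAdmissibleTriple (F : ℝ≥0 → ℝ≥0 → ℝ≥0 → ℝ≥0 → ℝ≥0)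
    (G : ℝ≥0 → ℝ≥0 → ℝ≥0 → ℝ≥0) (H : ℝ≥0 → ℝ≥0 → ℝ≥0) : Prop where
  admissible : IsAdmissible F
  mono_G : ∀ x y z x' y' z', x ≤ x' → y ≤ y' → z ≤ z' → G x y z ≤ G x' y' z'
  le_G : ∀ x y z, (x + y) * z ≤ G x y z
  mono_H : ∀ x y x' y', x ≤ x' → y ≤ y' → H x y ≤ H x' y'
  le_H : ∀ x y, 2 * x * y ≤ H x y

/-! ### Quantum compact metric spaces -/

section QuantumMetric

variable {A : Type u} [CStarAlgebra A]

/-- The state space `S(A)`, with the weak* topology inherited from `WeakDual ℂ A`. -/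
def stateSpace (A : Type u) [CStarAlgebra A] : Set (WeakDual ℂ A) :=
  {φ | φ 1 = 1 ∧ ∀ a : A, 0 ≤ φ (star a * a)}

/-- The Jordan product `a ∘ b = (ab + ba)/2` of self-adjoint elements. -/
def jordanProd (a b : selfAdjoint A) : selfAdjoint A := ℜ ((a : A) * (b : A))

/-- The Lie product `{a, b} = (ab - ba)/(2i)` of self-adjoint elements. -/
def lieProd (a b : selfAdjoint A) : selfAdjoint A := ℑ ((a : A) * (b : A))

theorem coe_jordanProd (a b : selfAdjoint A) :
    (jordanProd a b : A) = (2⁻¹ : ℝ) • ((a : A) * (b : A) + (b : A) * (a : A)) := by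
  simp [jordanProd, realPart_apply_coe]

theorem coe_lieProd (a b : selfAdjoint A) :
    (lieProd a b : A) =
      -Complex.I • (2⁻¹ : ℝ) • ((a : A) * (b : A) - (b : A) * (a : A)) := by
  simp [lieProd, imaginaryPart_apply_coe]

/-- The Monge-Kantorovich (extended) distance of a seminorm `L` on `sa(A)`. A seminorm defined on
a subspace `dom L` is encoded by the value `∞` off `dom L`. -/
def mongeKantorovich (L : selfAdjoint A → ℝ≥0∞) (φ ψ : WeakDual ℂ A) : ℝ≥0∞ :=
  ⨆ (a : selfAdjoint A) (_ : L a ≤ 1), ‖φ (a : A) - ψ (a : A)‖ₑ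

/-- `(A, L)` is an `F`-Leibniz quantum compact metric space. The domain of `L` is
`{a | L a ≠ ∞}`; it is a subspace by the seminorm laws, and it is closed under the Jordan and Lie
products by `leibniz`. -/
structure IsQuantumCompactMetricSpace (F : ℝ≥0 → ℝ≥0 → ℝ≥0 → ℝ≥0 → ℝ≥0)
    (L : selfAdjoint A → ℝ≥0∞) : Prop where
  admissible : IsAdmissible F
  add_le : ∀ a b, L (a + b) ≤ L a + L b
  smul_eq : ∀ (r : ℝ) (a), L (r • a) = ‖r‖ₑ * L a
  dense_dom : Dense {a | L a ≠ ⊤}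
  eq_zero_iff : ∀ a, L a = 0 ↔ ∃ r : ℝ, (a : A) = (r : ℂ) • (1 : A)
  mk_ne_top : ∀ φ ∈ stateSpace A, ∀ ψ ∈ stateSpace A, mongeKantorovich L φ ψ ≠ ⊤
  /-- the Monge-Kantorovich balls form neighbourhood bases of the weak* topology of `S(A)` -/
  mk_metrizes : ∀ φ : stateSpace A,
    (𝓝 φ).HasBasis (fun ε : ℝ≥0∞ => 0 < ε) (fun ε => {ψ | mongeKantorovich L φ ψ < ε})
  isClosed_ball : IsClosed {a | L a ≤ 1}
  leibniz : ∀ a b, L a ≠ ⊤ → L b ≠ ⊤ →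
    max (L (jordanProd a b)) (L (lieProd a b)) ≤
      (F ‖(a : A)‖₊ ‖(b : A)‖₊ (L a).toNNReal (L b).toNNReal : ℝ≥0∞)

end QuantumMetric

/-! ### Metrized quantum vector bundles -/

/-- A tuple `(M, ⟨·,·⟩, D, A, L)`; all requirements are in `IsMetrizedQuantumVectorBundle`. -/
structure BundleData : Type (u + 1) where
  A : Type u
  [cstarAlgebra : CStarAlgebra A]
  M : Type u
  [normedAddCommGroup : NormedAddCommGroup M]
  [moduleComplex : Module ℂ M]
  [module : Module A M]
  inner : M → M → A
  D : M → ℝ≥0∞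
  L : selfAdjoint A → ℝ≥0∞

attribute [instance] BundleData.cstarAlgebra BundleData.normedAddCommGroup
  BundleData.moduleComplex BundleData.module

/-- `(M, ⟨·,·⟩)` is a left Hilbert module over the unital C*-algebra `A`; the norm of `M` is the
one induced by the inner product. -/
structure IsLeftHilbertModule (A : Type u) [CStarAlgebra A] (M : Type u) [NormedAddCommGroup M]
    [Module ℂ M] [Module A M] (inner : M → M → A) : Prop where
  smul_assoc : ∀ (z : ℂ) (a : A) (ω : M), (z • a) • ω = z • (a • ω)
  add_left : ∀ ω ω' ν, inner (ω + ω') ν = inner ω ν + inner ω' ν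
  smul_left : ∀ (a : A) (ω ν : M), inner (a • ω) ν = a * inner ω ν
  star_inner : ∀ ω ν, star (inner ω ν) = inner ν ω
  nonneg : ∀ ω, ∃ a : A, inner ω ω = star a * a
  definite : ∀ ω, inner ω ω = 0 → ω = 0
  norm_eq : ∀ ω, ‖ω‖ = √‖inner ω ω‖
  complete : CompleteSpace M

/-- `Ω = (M, ⟨·,·⟩, D, A, L)` is an `(F, G, H)`-metrized quantum vector bundle. As for `L`, the
D-norm takes the value `∞` off its domain. -/
structure IsMetrizedQuantumVectorBundle (F : ℝ≥0 → ℝ≥0 → ℝ≥0 → ℝ≥0 → ℝ≥0)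
    (G : ℝ≥0 → ℝ≥0 → ℝ≥0 → ℝ≥0) (H : ℝ≥0 → ℝ≥0 → ℝ≥0) (Ω : BundleData.{u}) : Prop where
  admissible : IsAdmissibleTriple F G H
  base : IsQuantumCompactMetricSpace F Ω.L
  hilbert : IsLeftHilbertModule Ω.A Ω.M Ω.inner
  add_le : ∀ ω ν, Ω.D (ω + ν) ≤ Ω.D ω + Ω.D ν
  smul_eq : ∀ (z : ℂ) (ω), Ω.D (z • ω) = ‖z‖ₑ * Ω.D ω
  dense_dom : Dense {ω | Ω.D ω ≠ ⊤}
  norm_le : ∀ ω, ‖ω‖ₑ ≤ Ω.D ω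
  isCompact_ball : IsCompact {ω | Ω.D ω ≤ 1}
  leibniz_module : ∀ (a : selfAdjoint Ω.A) (ω : Ω.M), Ω.L a ≠ ⊤ → Ω.D ω ≠ ⊤ →
    Ω.D ((a : Ω.A) • ω) ≤ (G ‖(a : Ω.A)‖₊ (Ω.L a).toNNReal (Ω.D ω).toNNReal : ℝ≥0∞)
  leibniz_inner : ∀ ω ν : Ω.M, Ω.D ω ≠ ⊤ → Ω.D ν ≠ ⊤ →
    max (Ω.L (ℜ (Ω.inner ω ν))) (Ω.L (ℑ (Ω.inner ω ν))) ≤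
      (H (Ω.D ω).toNNReal (Ω.D ν).toNNReal : ℝ≥0∞)

/-! ### The modular Gromov-Hausdorff propinquity -/

/-- The Hausdorff distance of two sets for an extended pseudo-distance `d`. -/
def hausdorff {X : Type*} (d : X → X → ℝ≥0∞) (S T : Set X) : ℝ≥0∞ :=
  max (⨆ s ∈ S, ⨅ t ∈ T, d s t) (⨆ t ∈ T, ⨅ s ∈ S, d s t)

/-- The `1`-level set `S₁(D|x)`: by the Cauchy-Schwarz inequality, these are the states `φ` such
that `φ(xd) = φ(dx) = φ(d)` for all `d`. -/
def levelSet {D : Type u} [CStarAlgebra D] (x : D) : Set (WeakDual ℂ D) :=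
  {φ | φ ∈ stateSpace D ∧ φ (star (1 - x) * (1 - x)) = 0 ∧ φ ((1 - x) * star (1 - x)) = 0}

namespace BundleData

/-- The modular Monge-Kantorovich distance `k_Ω`. -/
def modularMK (Ω : BundleData.{u}) (ω ν : Ω.M) : ℝ≥0∞ :=
  ⨆ (ξ : Ω.M) (_ : Ω.D ξ ≤ 1), ‖Ω.inner ω ξ - Ω.inner ν ξ‖ₑ

/-- The closed unit ball of the D-norm. -/
def ball (Ω : BundleData.{u}) : Set Ω.M := {ω | Ω.D ω ≤ 1}

end BundleData

/-- A modular bridge `(D, x, π₁, π₂, (ω_j)_{j ∈ J}, (η_j)_{j ∈ J})` from `Ω₁` to `Ω₂`. -/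
structure ModularBridge (Ω₁ Ω₂ : BundleData.{u}) : Type (u + 1) where
  D : Type u
  [cstarAlgebra : CStarAlgebra D]
  pivot : D
  norm_pivot : ‖pivot‖ = 1
  levelSet_nonempty : (levelSet pivot).Nonempty
  π₁ : Ω₁.A →⋆ₐ[ℂ] D
  π₂ : Ω₂.A →⋆ₐ[ℂ] D
  injective₁ : Function.Injective π₁
  injective₂ : Function.Injective π₂
  J : Type u
  [nonempty : Nonempty J]
  anchor : J → Ω₁.M
  coanchor : J → Ω₂.M
  anchor_mem : ∀ j, anchor j ∈ Ω₁.ball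
  coanchor_mem : ∀ j, coanchor j ∈ Ω₂.ball

attribute [instance] ModularBridge.cstarAlgebra ModularBridge.nonempty

namespace ModularBridge

variable {Ω₁ Ω₂ : BundleData.{u}} (γ : ModularBridge Ω₁ Ω₂)

/-- The bridge seminorm. -/
def bn (a : Ω₁.A) (b : Ω₂.A) : ℝ≥0∞ := ‖γ.π₁ a * γ.pivot - γ.pivot * γ.π₂ b‖ₑ

/-- The height: how far the states of `A₁` and of `A₂` are from the restrictions of the states in
the `1`-level set of the pivot. -/
def height : ℝ≥0∞ :=
  max
    (hausdorff (mongeKantorovich Ω₁.L) (stateSpace Ω₁.A)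
      {φ | φ ∈ stateSpace Ω₁.A ∧ ∃ θ ∈ levelSet γ.pivot, ∀ a, φ a = θ (γ.π₁ a)})
    (hausdorff (mongeKantorovich Ω₂.L) (stateSpace Ω₂.A)
      {φ | φ ∈ stateSpace Ω₂.A ∧ ∃ θ ∈ levelSet γ.pivot, ∀ a, φ a = θ (γ.π₂ a)})

/-- The basic reach. -/
def basicReach : ℝ≥0∞ :=
  hausdorff (fun c d : γ.D => ‖c - d‖ₑ)
    {c | ∃ a : selfAdjoint Ω₁.A, Ω₁.L a ≤ 1 ∧ c = γ.π₁ a * γ.pivot}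
    {c | ∃ b : selfAdjoint Ω₂.A, Ω₂.L b ≤ 1 ∧ c = γ.pivot * γ.π₂ b}

/-- The deck seminorm. -/
def dn (ω : Ω₁.M) (η : Ω₂.M) : ℝ≥0∞ :=
  ⨆ j, max (γ.bn (Ω₁.inner ω (γ.anchor j)) (Ω₂.inner η (γ.coanchor j)))
    (γ.bn (Ω₁.inner (γ.anchor j) ω) (Ω₂.inner (γ.coanchor j) η))

/-- The modular reach. -/
def modularReach : ℝ≥0∞ := ⨆ j, γ.dn (γ.anchor j) (γ.coanchor j)

/-- The imprint. -/
def imprint : ℝ≥0∞ :=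
  max (hausdorff Ω₁.modularMK (Set.range γ.anchor) Ω₁.ball)
    (hausdorff Ω₂.modularMK (Set.range γ.coanchor) Ω₂.ball)

/-- The reach. -/
def reach : ℝ≥0∞ := max γ.basicReach (γ.modularReach + γ.imprint)

/-- The length. -/
def length : ℝ≥0∞ := max γ.height γ.reach

end ModularBridge

/-- A modular trek: a finite nonempty chain of modular bridges through
`(F, G, H)`-metrized quantum vector bundles. -/
inductive ModularTrek (F : ℝ≥0 → ℝ≥0 → ℝ≥0 → ℝ≥0 → ℝ≥0)
    (G : ℝ≥0 → ℝ≥0 → ℝ≥0 → ℝ≥0) (H : ℝ≥0 → ℝ≥0 → ℝ≥0) :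
    BundleData.{u} → BundleData.{u} → Type (u + 1)
  | single {Ω₁ Ω₂ : BundleData.{u}} (h₁ : IsMetrizedQuantumVectorBundle F G H Ω₁)
      (h₂ : IsMetrizedQuantumVectorBundle F G H Ω₂) (γ : ModularBridge Ω₁ Ω₂) :
      ModularTrek F G H Ω₁ Ω₂
  | cons {Ω₁ Ω₂ Ω₃ : BundleData.{u}} (h₁ : IsMetrizedQuantumVectorBundle F G H Ω₁)
      (γ : ModularBridge Ω₁ Ω₂) (Γ : ModularTrek F G H Ω₂ Ω₃) : ModularTrek F G H Ω₁ Ω₃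

/-- The length of a trek is the sum of the lengths of its bridges. -/
def ModularTrek.length {F : ℝ≥0 → ℝ≥0 → ℝ≥0 → ℝ≥0 → ℝ≥0} {G : ℝ≥0 → ℝ≥0 → ℝ≥0 → ℝ≥0}
    {H : ℝ≥0 → ℝ≥0 → ℝ≥0} :
    {Ω₁ Ω₂ : BundleData.{u}} → ModularTrek F G H Ω₁ Ω₂ → ℝ≥0∞
  | _, _, .single _ _ γ => γ.length
  | _, _, .cons _ γ Γ => γ.length + Γ.length

/-- The modular Gromov-Hausdorff propinquity `Λ^mod` on `(F, G, H)`-metrized quantum vector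
bundles. -/
def modularPropinquity (F : ℝ≥0 → ℝ≥0 → ℝ≥0 → ℝ≥0 → ℝ≥0)
    (G : ℝ≥0 → ℝ≥0 → ℝ≥0 → ℝ≥0) (H : ℝ≥0 → ℝ≥0 → ℝ≥0) (Ω₁ Ω₂ : BundleData.{u}) : ℝ≥0∞ :=
  ⨅ Γ : ModularTrek F G H Ω₁ Ω₂, Γ.length

/-! ### The AF setting -/

section AF

variable {A : Type u} [CStarAlgebra A]

/-- Faithful tracial states. -/
structure IsFaithfulTracialState (τ : WeakDual ℂ A) : Prop where
  state : τ ∈ stateSpace A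
  tracial : ∀ a b : A, τ (a * b) = τ (b * a)
  faithful : ∀ a : A, τ (star a * a) = 0 → a = 0

/-- `E` is a `τ`-preserving conditional expectation of `A` onto `S`. -/
structure IsPreservingCondExp (τ : WeakDual ℂ A) (S : StarSubalgebra ℂ A) (E : A →ₗ[ℂ] A) :
    Prop where
  mem : ∀ a, E a ∈ S
  apply_of_mem : ∀ a ∈ S, E a = a
  bimodule : ∀ s ∈ S, ∀ t ∈ S, ∀ a, E (s * a * t) = s * E a * t
  positive : ∀ a, ∃ b, E (star a * a) = star b * b
  norm_le : ∀ a, ‖E a‖ ≤ ‖a‖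
  preserving : ∀ a, τ (E a) = τ a

/-- The `τ`-preserving conditional expectation onto `S`. -/
def condExp (τ : WeakDual ℂ A) (S : StarSubalgebra ℂ A) : A →ₗ[ℂ] A :=
  Classical.epsilon (IsPreservingCondExp τ S)

/-- `e` is the unit of `I ∩ S`. -/
structure IsIdealUnit (I : Ideal A) (S : StarSubalgebra ℂ A) (e : A) : Prop where
  mem_ideal : e ∈ I
  mem_subalgebra : e ∈ S
  one_mul : ∀ a, a ∈ I → a ∈ S → e * a = a
  mul_one : ∀ a, a ∈ I → a ∈ S → a * e = a

/-- The unit of the finite-dimensional algebra `I ∩ S`. -/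
def idealUnit (I : Ideal A) (S : StarSubalgebra ℂ A) : A :=
  Classical.epsilon (IsIdealUnit I S)

/-- `L_β(a) = sup_n ‖a - E_n(a)‖ / β(n)`. -/
def Lβ (S : ℕ → StarSubalgebra ℂ A) (τ : WeakDual ℂ A) (β : ℕ → ℝ) (a : A) : ℝ≥0∞ :=
  ⨆ n, ENNReal.ofReal (‖a - condExp τ (S n) a‖ / β n)

/-- `D_I(ω) = max {L_β(ω), ‖ω‖, sup_n ‖ω - ω 1_n‖ / β(n)}`. -/
def DI (S : ℕ → StarSubalgebra ℂ A) (τ : WeakDual ℂ A) (β : ℕ → ℝ) (I : Ideal A) (ω : A) :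
    ℝ≥0∞ :=
  max (max (Lβ S τ β ω) ‖ω‖ₑ)
    (⨆ n, ENNReal.ofReal (‖ω - ω * idealUnit I (S n)‖ / β n))

/-- `Ω_I = (I, ωη*, D_I, A, L_β)`. -/
def idealBundle (S : ℕ → StarSubalgebra ℂ A) (τ : WeakDual ℂ A) (β : ℕ → ℝ) (I : Ideal A) :
    BundleData.{u} where
  A := A
  M := I
  inner ω η := (ω : A) * star (η : A)
  D ω := DI S τ β I ω
  L a := Lβ S τ β a

/-- A finite-dimensional *-subalgebra of a C*-algebra is a C*-algebra. -/
abbrev finDimCStarAlgebra (T : StarSubalgebra ℂ A) [FiniteDimensional ℂ T] : CStarAlgebra T :=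
  StarSubalgebra.cstarAlgebra T
    (h_closed := Submodule.closed_of_finiteDimensional (Subalgebra.toSubmodule T.toSubalgebra))

/-- `Ω_{I_n} = (I_n, ωη*, D_I, A_n, L_β)` with `I_n = I ∩ A_n`, an ideal of `A_n`. -/
def finiteIdealBundle (S : ℕ → StarSubalgebra ℂ A) [∀ n, FiniteDimensional ℂ (S n)]
    (τ : WeakDual ℂ A) (β : ℕ → ℝ) (I : Ideal A) (n : ℕ) : BundleData.{u} :=
  letI : CStarAlgebra (S n) := finDimCStarAlgebra (S n)
  { A := S n
    M := (I.comap (S n).subtype : Ideal (S n))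
    inner := fun ω η => (ω : S n) * star (η : S n)
    D := fun ω => DI S τ β I ((ω : S n) : A)
    L := fun a => Lβ S τ β ((a : S n) : A) }

end AF

/-- `F(x₁, x₂, x₃, x₄) = 2 (x₁ x₄ + x₂ x₃)`. -/
def F₂ (x₁ x₂ x₃ x₄ : ℝ≥0) : ℝ≥0 := 2 * (x₁ * x₄ + x₂ * x₃)

/-- `G(x, y, z) = F(x, y, z, z)`. -/
def G₂ (x y z : ℝ≥0) : ℝ≥0 := F₂ x y z z

/-- `H(x, y) = F(x, x, y, y)`. -/
def H₂ (x y : ℝ≥0) : ℝ≥0 := F₂ x x y y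

/-- `x_n = max {1 + β(n), max_{m < n} (2 β(n) + β(m)) / β(m)}`. -/
def xSeq (β : ℕ → ℝ) (n : ℕ) : ℝ :=
  max (1 + β n) (⨆ m : Fin n, (2 * β n + β m) / β m)

end ModularPropinquity

end

/-!
The `τ`-preserving conditional expectation `E_n` and the unit `1_n` of `I ∩ A_n` both come from the
trace form `(a, b) ↦ τ (a b)`, which is nondegenerate on `A_n` and on `I ∩ A_n`
(`exists_traceProjection`): `E_n(a)` represents the functional `s ↦ τ (s a)` on `A_n`, and `1_n`
represents the restriction of `τ` to `I ∩ A_n`. The units form an approximate identity because the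
distance of an element of `A_n` to `I` is attained in `I ∩ A_n` (`norm_sub_mul_idealUnit_le`).

Since `‖a - E_n(a)‖` is at most twice the distance of `a` to `A_n`, the seminorm `L_β` has the
Leibniz property with constant `2` (`Lβ_mul_le`). Since `β(n) → 0`, the maps `E_n` approximate the
identity uniformly on the unit ball of `L_β`, so that its bounded parts are compact
(`isCompact_Lβ_le_one`); this gives the quantum metric space structure and the compactness of the
unit balls of the D-norms. Both kinds of bundles are instances of
`isMetrizedQuantumVectorBundle`.

The propinquity is estimated by one bridge (`inclusionBridge`), in `A` with pivot `1`, whose anchors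
and co-anchors are the elements of the unit ball of the D-norm of `I ∩ A_n`. Its height vanishes as
states extend along `E_n`, its basic reach is at most `β(n)`, and its modular reach vanishes. So the
length is governed by the distance of an element `ω` of the unit ball of `D_I` to the unit ball of
the D-norm of `I ∩ A_n`. Write `b = β(n)`, `p = 1_n`, `y = x_n - 1`. If `b` or `y` is at least `1`,
the zero element will do. Otherwise the approximation is `s⁻¹ E_n(ω) p` with `s = 1 + y - b`. Its
D-norm is at most `1` (`DI_condExp_mul_idealUnit_le`): with `e = E_n(ω)`, the element
`e p - (1 - b) e = b e p - (1 - b) e (1 - p)` has norm at most `b`, because the two terms live in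
orthogonal corners, so that for `m < n` the distance of `e p` to its conditional expectation is at
most `(1 - b) β(m) + 2 b ≤ s β(m)`. The resulting distance is at most `y / s + b ^ 2`
(`exists_norm_sub_mul_star_le`), where the square appears because both `ω` and the test elements of
the modular Monge-Kantorovich distance are within `b` of their products with `p`. This is at most
`y + b ^ 2`, and at most `y` if `2 b ≤ y`, which holds when `β(m) ≤ 1` for some `m < n`.
-/

namespace ModularPropinquity

/-! ### Conditional expectations -/

section CondExp

variable {A : Type u} [CStarAlgebra A]

theorem state_star {φ : WeakDual ℂ A} (hφ : φ ∈ stateSpace A) (a : A) :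
    φ (star a) = star (φ a) := by
  have him : ∀ y : A, (φ (star y * y)).im = 0 := fun y => (Complex.le_def.1 (hφ.2 y)).2.symm
  have e1 : star (1 + a) * (1 + a) = 1 + a + star a + star a * a := by
    simp only [star_add, star_one]; noncomm_ring
  have e2 : star (1 + Complex.I • a) * (1 + Complex.I • a)
      = 1 + Complex.I • a - Complex.I • star a + star a * a := by
    simp only [star_add, star_one, star_smul, mul_add, add_mul, smul_mul_smul_comm,
      Complex.star_def, Complex.conj_I, neg_mul, Complex.I_mul_I, neg_neg, one_smul, mul_one,
      one_mul, neg_smul]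
    abel
  have h1 := him (1 + a)
  have h2 := him (1 + Complex.I • a)
  have h3 := him a
  rw [e1] at h1
  rw [e2] at h2
  simp only [map_add, map_sub, map_smul, hφ.1, Complex.add_im, Complex.sub_im, Complex.one_im,
    smul_eq_mul, Complex.mul_im, Complex.I_re, Complex.I_im, h3] at h1 h2
  apply Complex.ext
  · simp only [Complex.star_def, Complex.conj_re]; linarith
  · simp only [Complex.star_def, Complex.conj_im]; linarith

/-- If the trace form `(j, k) ↦ τ (j k)` is nondegenerate on a finite-dimensional subspace, then
every element has a component in the subspace with the same pairing with the subspace. -/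
theorem exists_traceProjection (τ : WeakDual ℂ A) (J : Submodule ℂ A) [FiniteDimensional ℂ J]
    (hJ : ∀ k ∈ J, (∀ j ∈ J, τ (j * k) = 0) → k = 0) :
    ∃ P : A →ₗ[ℂ] A, (∀ a, P a ∈ J) ∧ ∀ a, ∀ j ∈ J, τ (j * P a) = τ (j * a) := by
  let Φ : A →ₗ[ℂ] J →ₗ[ℂ] ℂ := LinearMap.mk₂ ℂ (fun a (j : J) => τ ((j : A) * a))
    (fun a b j => by rw [mul_add, map_add])
    (fun c a j => by rw [mul_smul_comm, map_smul])
    (fun a j k => by rw [Submodule.coe_add, add_mul, map_add])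
    (fun c a j => by rw [Submodule.coe_smul, smul_mul_assoc, map_smul])
  have hΦ : ∀ a (j : J), Φ a j = τ ((j : A) * a) := fun _ _ => rfl
  have hinj : Function.Injective (Φ ∘ₗ J.subtype) := by
    rw [injective_iff_map_eq_zero]
    intro k hk
    refine Subtype.ext (hJ k k.2 fun j hj => ?_)
    have := LinearMap.congr_fun hk ⟨j, hj⟩
    simpa [hΦ] using this
  have hsurj : Function.Surjective (Φ ∘ₗ J.subtype) :=
    (LinearMap.injective_iff_surjective_of_finrank_eq_finrank
      (Subspace.dual_finrank_eq (K := ℂ) (V := J)).symm).1 hinj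
  let e := LinearEquiv.ofBijective (Φ ∘ₗ J.subtype) ⟨hinj, hsurj⟩
  refine ⟨J.subtype ∘ₗ e.symm.toLinearMap ∘ₗ Φ, fun a => (e.symm (Φ a)).2, fun a j hj => ?_⟩
  have := LinearMap.congr_fun (e.apply_symm_apply (Φ a)) ⟨j, hj⟩
  rw [hΦ] at this
  rw [← this]
  rfl

/-- An element on which every compression by a faithful positive functional is nonnegative is
positive: test the functional against the square root of its negative part. -/
theorem exists_eq_star_mul_self_of_faithful {B : Type*} [CStarAlgebra B] (t : B →ₗ[ℂ] ℂ)
    (ht : ∀ b, 0 ≤ t (star b * b)) (hf : ∀ b, t (star b * b) = 0 → b = 0) {h : B}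
    (hh : IsSelfAdjoint h) (hpos : ∀ b, 0 ≤ t (star b * h * b)) : ∃ b, h = star b * b := by
  let n : ℝ → ℝ := fun x => max (-x) 0
  let r : ℝ → ℝ := fun x => √(max (-x) 0)
  have hr : IsSelfAdjoint (cfc r h) := cfc_predicate r h
  have hn : IsSelfAdjoint (cfc n h) := cfc_predicate n h
  have cr : Continuous r := by fun_prop
  have cn : Continuous n := by fun_prop
  have key : star (cfc r h) * h * cfc r h = -(star (cfc n h) * cfc n h) := by
    rw [hr.star_eq, hn.star_eq]
    nth_rw 2 [← cfc_id ℝ h]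
    rw [← cfc_mul r id h cr.continuousOn continuousOn_id,
      ← cfc_mul (fun x => r x * id x) r h (cr.mul continuous_id).continuousOn cr.continuousOn,
      ← cfc_mul n n h cn.continuousOn cn.continuousOn, ← cfc_neg]
    congr 1
    funext x
    rcases le_total 0 (-x) with hx | hx
    · simp only [r, n, max_eq_left hx, id]
      have := Real.mul_self_sqrt hx
      linear_combination x * this
    · simp [r, n, max_eq_right hx]
  have h0 : cfc n h = 0 := by
    apply hf
    have := hpos (cfc r h)
    rw [key, map_neg] at this
    exact le_antisymm (by simpa using this) (ht _)
  let q : ℝ → ℝ := fun x => √(max x 0)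
  have cq : Continuous q := by fun_prop
  have hq : IsSelfAdjoint (cfc q h) := cfc_predicate q h
  refine ⟨cfc q h, ?_⟩
  rw [hq.star_eq, ← cfc_mul q q h cq.continuousOn cq.continuousOn]
  have : cfc (fun x => q x * q x) h = cfc (fun x => id x + n x) h := by
    congr 1
    funext x
    simp only [q, n, id, Real.mul_self_sqrt (le_max_right x 0)]
    rcases le_total 0 x with hx | hx
    · rw [max_eq_left hx, max_eq_right (by linarith)]; ring
    · rw [max_eq_right hx, max_eq_left (by linarith)]; ring
  rw [this, cfc_add (a := h) id n continuousOn_id cn.continuousOn, h0, add_zero, cfc_id ℝ h]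

theorem norm_le_of_sub_eq_star_mul_self {x y c d : A}
    (h : star y * y - star x * x = star c * c + star d * d) : ‖x‖ ≤ ‖y‖ := by
  let _ := CStarAlgebra.spectralOrder A
  let _ := CStarAlgebra.spectralOrderedRing A
  have h1 : star x * x ≤ star y * y := by
    rw [← sub_nonneg, h]
    exact add_nonneg (star_mul_self_nonneg c) (star_mul_self_nonneg d)
  have h2 := CStarAlgebra.norm_le_norm_of_nonneg_of_le (star_mul_self_nonneg x) h1
  rw [CStarRing.norm_star_mul_self, CStarRing.norm_star_mul_self] at h2
  exact le_of_sq_le_sq (by nlinarith) (norm_nonneg y)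

theorem exists_sq_sub_eq_star_mul_self {a : A} {r : ℝ} (h : ‖a‖ ≤ r) :
    ∃ c : A, algebraMap ℝ A (r ^ 2) - star a * a = star c * c := by
  let _ := CStarAlgebra.spectralOrder A
  let _ := CStarAlgebra.spectralOrderedRing A
  have h' : ‖a‖ ^ 2 ≤ r ^ 2 := by gcongr
  have h : 0 ≤ algebraMap ℝ A (r ^ 2) - star a * a :=
    sub_nonneg.2 (CStarAlgebra.star_mul_le_algebraMap_norm_sq.trans (algebraMap_mono A h'))
  exact CStarAlgebra.nonneg_iff_eq_star_mul_self.1 h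

theorem IsFaithfulTracialState.eq_of_forall_mul {τ : WeakDual ℂ A}
    (hτ : IsFaithfulTracialState τ) {S : StarSubalgebra ℂ A} {x y : A} (hx : x ∈ S) (hy : y ∈ S)
    (h : ∀ s ∈ S, τ (s * x) = τ (s * y)) : x = y := by
  rw [← sub_eq_zero]
  apply hτ.faithful
  rw [mul_sub, map_sub, h _ (star_mem (sub_mem hx hy)), sub_self]

theorem IsPreservingCondExp.apply_mul {τ : WeakDual ℂ A} {S : StarSubalgebra ℂ A}
    {E : A →ₗ[ℂ] A} (hE : IsPreservingCondExp τ S E) {s : A} (hs : s ∈ S) (a : A) :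
    τ (s * E a) = τ (s * a) := by
  have := hE.bimodule s hs 1 (one_mem S) a
  rw [mul_one, mul_one] at this
  rw [← this, hE.preserving]

theorem IsPreservingCondExp.unique {τ : WeakDual ℂ A} (hτ : IsFaithfulTracialState τ)
    {S : StarSubalgebra ℂ A} {E E' : A →ₗ[ℂ] A} (hE : IsPreservingCondExp τ S E)
    (hE' : IsPreservingCondExp τ S E') : E = E' :=
  LinearMap.ext fun a => hτ.eq_of_forall_mul (hE.mem a) (hE'.mem a) fun s hs => by
    rw [hE.apply_mul hs, hE'.apply_mul hs]

/-- The `τ`-preserving conditional expectation is the orthogonal projection for the inner product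
`(a, b) ↦ τ (a* b)`; traciality makes it a bimodule map. -/
theorem exists_isPreservingCondExp {τ : WeakDual ℂ A} (hτ : IsFaithfulTracialState τ)
    (S : StarSubalgebra ℂ A) [FiniteDimensional ℂ S] :
    ∃ E : A →ₗ[ℂ] A, IsPreservingCondExp τ S E ∧
      (∀ a, ∃ b ∈ S, E (star a * a) = star b * b) ∧ ∀ a, E (star a) = star (E a) := by
  have : FiniteDimensional ℂ (Subalgebra.toSubmodule S.toSubalgebra) :=
    inferInstanceAs (FiniteDimensional ℂ S)
  obtain ⟨E, hmem, hE⟩ := exists_traceProjection τ (Subalgebra.toSubmodule S.toSubalgebra)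
    fun k hk h => hτ.faithful k (h _ (star_mem (S := StarSubalgebra ℂ A) (s := S) hk))
  replace hmem : ∀ a, E a ∈ S := hmem
  replace hE : ∀ a, ∀ j ∈ S, τ (j * E a) = τ (j * a) := hE
  have happ : ∀ a ∈ S, E a = a := fun a ha =>
    hτ.eq_of_forall_mul (hmem a) ha fun s hs => hE a s hs
  have hbi : ∀ s ∈ S, ∀ t ∈ S, ∀ a, E (s * a * t) = s * E a * t := by
    intro s hs t ht a
    refine hτ.eq_of_forall_mul (hmem _) (mul_mem (mul_mem hs (hmem a)) ht) fun r hr => ?_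
    have h1 : ∀ x : A, τ (r * (s * x * t)) = τ (t * r * s * x) := fun x => by
      rw [← mul_assoc, hτ.tracial]
      simp only [mul_assoc]
    rw [hE _ _ hr, h1, h1, hE _ _ (mul_mem (mul_mem ht hr) hs)]
  have hstar : ∀ a, E (star a) = star (E a) := by
    intro a
    refine hτ.eq_of_forall_mul (hmem _) (star_mem (hmem a)) fun s hs => ?_
    have h1 : ∀ x : A, τ (s * star x) = star (τ (star s * x)) := fun x => by
      rw [← state_star hτ.state, star_mul, star_star, hτ.tracial]
    rw [hE _ _ hs, h1, h1, hE _ _ (star_mem hs)]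
  have hpres : ∀ a, τ (E a) = τ a := fun a => by simpa using hE a 1 (one_mem S)
  have hpos : ∀ a, ∃ b ∈ S, E (star a * a) = star b * b := by
    intro a
    let _ : CStarAlgebra S := finDimCStarAlgebra S
    obtain ⟨b, hb⟩ := exists_eq_star_mul_self_of_faithful (B := S)
      ((τ : A →L[ℂ] ℂ).toLinearMap ∘ₗ S.subtype.toLinearMap)
      (fun b => hτ.state.2 b) (fun b hb => Subtype.ext (hτ.faithful b hb))
      (h := ⟨E (star a * a), hmem _⟩)
      (Subtype.ext (by
        change star (E (star a * a)) = _
        rw [← hstar, star_mul, star_star]))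
      (fun b => by
        change 0 ≤ τ (star (b : A) * E (star a * a) * (b : A))
        rw [← hbi _ (star_mem b.2) _ b.2, hpres]
        have := hτ.state.2 (a * b)
        rwa [star_mul, ← mul_assoc, mul_assoc (star (b : A))] at this)
    exact ⟨b, b.2, congrArg Subtype.val hb⟩
  refine ⟨E, ⟨hmem, happ, hbi, fun a => ?_, fun a => ?_, hpres⟩, hpos, hstar⟩
  · obtain ⟨b, -, hb⟩ := hpos a
    exact ⟨b, hb⟩
  -- `E(a)* E(a) ≤ E(a* a) ≤ ‖a‖²` by positivity at `a - E a` and at a root of `‖a‖² - a* a`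
  · obtain ⟨c, hc⟩ := exists_sq_sub_eq_star_mul_self (le_refl ‖a‖)
    obtain ⟨c', -, hc'⟩ := hpos c
    obtain ⟨d, -, hd⟩ := hpos (a - E a)
    have h1 : E (star (a - E a) * (a - E a)) = E (star a * a) - star (E a) * E a := by
      -- the factors `1` bring the cross terms into the form of the bimodule law
      have e : star (a - E a) * (a - E a)
          = star a * a - star (E a) * a * 1 - 1 * star a * E a + star (E a) * E a := by
        rw [star_sub]; noncomm_ring
      rw [e, map_add, map_sub, map_sub, hbi _ (star_mem (hmem a)) _ (one_mem S),
        hbi _ (one_mem S) _ (hmem a), hstar, happ _ (mul_mem (star_mem (hmem a)) (hmem a))]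
      noncomm_ring
    have h2 : algebraMap ℝ A (‖a‖ ^ 2) ∈ S := by
      rw [IsScalarTower.algebraMap_apply ℝ ℂ A]
      exact algebraMap_mem S _
    have h3 : algebraMap ℝ A (‖a‖ ^ 2) - star (E a) * E a = star c' * c' + star d * d := by
      rw [← hc', ← hd, h1, ← hc, map_sub, happ _ h2]
      abel
    have h4 : algebraMap ℝ A (‖a‖ ^ 2)
        = star (algebraMap ℝ A ‖a‖) * algebraMap ℝ A ‖a‖ := by
      rw [← algebraMap_star_comm, ← map_mul, star_trivial, sq]
    rw [h4] at h3
    have h5 := norm_le_of_sub_eq_star_mul_self h3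
    have : Nontrivial A := ⟨1, 0, fun h => by
      have := hτ.state.1
      rw [h, map_zero] at this
      exact zero_ne_one this⟩
    rwa [norm_algebraMap', norm_norm] at h5

theorem existsUnique_isPreservingCondExp {τ : WeakDual ℂ A} (hτ : IsFaithfulTracialState τ)
    (S : StarSubalgebra ℂ A) [FiniteDimensional ℂ S] :
    ∃! E : A →ₗ[ℂ] A, IsPreservingCondExp τ S E := by
  obtain ⟨E, hE, -⟩ := exists_isPreservingCondExp hτ S
  exact ⟨E, hE, fun E' hE' => hE'.unique hτ hE⟩

theorem condExp_spec {τ : WeakDual ℂ A} (hτ : IsFaithfulTracialState τ)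
    (S : StarSubalgebra ℂ A) [FiniteDimensional ℂ S] :
    IsPreservingCondExp τ S (condExp τ S) ∧
      (∀ a, ∃ b ∈ S, condExp τ S (star a * a) = star b * b) ∧
      ∀ a, condExp τ S (star a) = star (condExp τ S a) := by
  obtain ⟨E, hE, h⟩ := exists_isPreservingCondExp hτ S
  have h1 : IsPreservingCondExp τ S (condExp τ S) := Classical.epsilon_spec ⟨E, hE⟩
  rw [← hE.unique hτ h1]
  exact ⟨hE, h⟩

end CondExp

/-! ### Units of the ideals `I ∩ A_n` -/

section IdealUnit

variable {A : Type u} [CStarAlgebra A]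

/-- The unit of `I ∩ S` is the component of `1` in `I ∩ S` for the trace form. The form is
nondegenerate because, together with `k`, a two-sided ideal contains `k* k k*`, whose pairing with
`k` is `τ ((k* k)²)`. -/
theorem exists_isIdealUnit {τ : WeakDual ℂ A} (hτ : IsFaithfulTracialState τ)
    (S : StarSubalgebra ℂ A) [FiniteDimensional ℂ S] (I : Ideal A) [I.IsTwoSided] :
    ∃ e : A, IsIdealUnit I S e := by
  have : FiniteDimensional ℂ (Subalgebra.toSubmodule S.toSubalgebra) :=
    inferInstanceAs (FiniteDimensional ℂ S)
  let J : Submodule ℂ A := I.restrictScalars ℂ ⊓ Subalgebra.toSubmodule S.toSubalgebra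
  have hJmem : ∀ x, x ∈ J ↔ x ∈ I ∧ x ∈ S := fun x => Iff.rfl
  have : FiniteDimensional ℂ J := Submodule.finiteDimensional_of_le inf_le_right
  obtain ⟨P, hmem, hP⟩ := exists_traceProjection τ J (by
    intro k hk h
    rw [hJmem] at hk
    have h1 : star k * k * star k ∈ J := (hJmem _).2
      ⟨I.mul_mem_right _ (I.mul_mem_left _ hk.1),
        mul_mem (mul_mem (star_mem hk.2) hk.2) (star_mem hk.2)⟩
    rw [← CStarRing.star_mul_self_eq_zero_iff]
    apply hτ.faithful
    rw [star_mul, star_star, ← mul_assoc]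
    exact h _ h1)
  have he := (hJmem _).1 (hmem 1)
  have hP1 : ∀ j, j ∈ I → j ∈ S → τ (j * P 1) = τ j := fun j hjI hjS => by
    rw [hP 1 j ((hJmem _).2 ⟨hjI, hjS⟩), mul_one]
  refine ⟨P 1, he.1, he.2, fun a haI haS => ?_, fun a haI haS => ?_⟩
  · refine hτ.eq_of_forall_mul (mul_mem he.2 haS) haS fun s hs => ?_
    rw [← mul_assoc, hτ.tracial, ← mul_assoc, hP1 _ (I.mul_mem_right _ haI) (mul_mem haS hs),
      hτ.tracial]
  · refine hτ.eq_of_forall_mul (mul_mem haS he.2) haS fun s hs => ?_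
    rw [← mul_assoc, hP1 _ (I.mul_mem_left _ haI) (mul_mem hs haS)]

theorem existsUnique_isIdealUnit {τ : WeakDual ℂ A} (hτ : IsFaithfulTracialState τ)
    (S : StarSubalgebra ℂ A) [FiniteDimensional ℂ S] (I : Ideal A) [I.IsTwoSided] :
    ∃! e : A, IsIdealUnit I S e := by
  obtain ⟨e, he⟩ := exists_isIdealUnit hτ S I
  exact ⟨e, he, fun e' he' => by
    rw [← he.one_mul _ he'.mem_ideal he'.mem_subalgebra, he'.mul_one _ he.mem_ideal
      he.mem_subalgebra]⟩

theorem idealUnit_spec {τ : WeakDual ℂ A} (hτ : IsFaithfulTracialState τ)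
    (S : StarSubalgebra ℂ A) [FiniteDimensional ℂ S] (I : Ideal A) [I.IsTwoSided] :
    IsIdealUnit I S (idealUnit I S) :=
  Classical.epsilon_spec (exists_isIdealUnit hτ S I)

theorem norm_le_one_of_isStarProjection {p : A} (hp : IsStarProjection p) : ‖p‖ ≤ 1 := by
  have h : ‖p‖ = ‖p‖ * ‖p‖ := by
    rw [← CStarRing.norm_star_mul_self, hp.isSelfAdjoint.star_eq, hp.isIdempotentElem.eq]
  by_contra! h1
  nlinarith

variable {I : Ideal A} [I.IsTwoSided] {S : StarSubalgebra ℂ A} {p : A}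

theorem IsIdealUnit.commute (hp : IsIdealUnit I S p) {s : A} (hs : s ∈ S) : p * s = s * p := by
  rw [← hp.mul_one (p * s) (I.mul_mem_right _ hp.mem_ideal) (mul_mem hp.mem_subalgebra hs),
    mul_assoc, hp.one_mul _ (I.mul_mem_left _ hp.mem_ideal) (mul_mem hs hp.mem_subalgebra)]

theorem IsIdealUnit.isStarProjection (hp : IsIdealUnit I S p) : IsStarProjection p :=
  isStarProjection_iff_isIdempotentElem_and_isStarNormal.2
    ⟨hp.one_mul _ hp.mem_ideal hp.mem_subalgebra,
      ⟨(hp.commute (star_mem hp.mem_subalgebra)).symm⟩⟩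

theorem IsIdealUnit.star_eq (hp : IsIdealUnit I S p) : star p = p :=
  hp.isStarProjection.isSelfAdjoint.star_eq

theorem IsIdealUnit.mul_self (hp : IsIdealUnit I S p) : p * p = p :=
  hp.isStarProjection.isIdempotentElem.eq

theorem IsIdealUnit.norm_le (hp : IsIdealUnit I S p) : ‖p‖ ≤ 1 :=
  norm_le_one_of_isStarProjection hp.isStarProjection

theorem IsIdealUnit.norm_one_sub_le (hp : IsIdealUnit I S p) : ‖1 - p‖ ≤ 1 :=
  norm_le_one_of_isStarProjection hp.isStarProjection.one_sub

/-- The distance of an element of `S` to the ideal is at least its distance to `I ∩ S`: the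
*-homomorphism `S / (I ∩ S) → A / I` is isometric. If the inequality failed, then a nonzero element
of `I ∩ S`, orthogonal to the unit of `I ∩ S`, would be obtained by functional calculus and a
Neumann series. -/
theorem norm_sub_mul_idealUnit_le (hp : IsIdealUnit I S p) [FiniteDimensional ℂ S] {a ω : A}
    (ha : a ∈ S) (hω : ω ∈ I) :
    ‖a - a * p‖ ≤ ‖a - ω‖ := by
  set b : A := a * (1 - p) with hb
  set w : A := ω * (1 - p) with hw
  have hbS : b ∈ S := mul_mem ha (sub_mem (one_mem S) hp.mem_subalgebra)
  have hwI : w ∈ I := I.mul_mem_right _ hω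
  have hbp : b * p = 0 := by rw [hb, mul_assoc, sub_mul, one_mul, hp.mul_self, sub_self, mul_zero]
  have hle : ‖b - w‖ ≤ ‖a - ω‖ := by
    rw [hb, hw, ← sub_mul]
    exact (norm_mul_le _ _).trans (mul_le_of_le_one_right (norm_nonneg _) hp.norm_one_sub_le)
  have hab : a - a * p = b := by rw [hb, mul_sub, mul_one]
  rw [hab]
  clear_value b w
  refine le_trans ?_ hle
  by_contra! hlt
  set r := ‖b - w‖
  obtain ⟨t, hrt, htb⟩ := exists_between hlt
  have hr0 : 0 ≤ r := norm_nonneg _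
  have ht0 : 0 < t := hr0.trans_lt hrt
  set h : A := star b * b with hh
  have hsa : IsSelfAdjoint h := IsSelfAdjoint.star_mul_self b
  have hs0 : 0 < t ^ 2 := by positivity
  -- `g(h)` lives where `h > t²`, and there `f(h)` inverts `h`
  let g : ℝ → ℝ := fun x => max (x - t ^ 2) 0
  let f : ℝ → ℝ := fun x => (max |x| (t ^ 2))⁻¹
  have hmax : ∀ x : ℝ, 0 < max |x| (t ^ 2) := fun x => lt_max_of_lt_right hs0
  have cg : Continuous g := by fun_prop
  have cf : Continuous f :=
    (by fun_prop : Continuous fun x : ℝ => max |x| (t ^ 2)).inv₀ fun x => (hmax x).ne'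
  set q := cfc g h
  set k := cfc f h
  have hk : IsSelfAdjoint k := cfc_predicate f h
  have hqS : q ∈ S := by
    have hc : IsClosed (S : Set A) :=
      Submodule.closed_of_finiteDimensional (Subalgebra.toSubmodule S.toSubalgebra)
    exact cfc_mem (𝕜' := ℂ) (hs := hc) g (mul_mem (star_mem hbS) hbS)
  have hqkh : q * (k * h) = q := by
    nth_rw 1 [← cfc_id ℝ h]
    rw [← cfc_mul f id h cf.continuousOn continuousOn_id,
      ← cfc_mul g (fun x => f x * id x) h cg.continuousOn (cf.mul continuous_id).continuousOn]
    congr 1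
    funext x
    rcases le_total x (t ^ 2) with hx | hx
    · simp [g, max_eq_right (sub_nonpos.2 hx)]
    · have hx0 : 0 < x := hs0.trans_le hx
      simp only [f, id, abs_of_pos hx0, max_eq_left hx, inv_mul_cancel₀ hx0.ne', mul_one]
  have hz : ‖k * star b * (b - w)‖ < 1 := by
    have h1 : ‖k * star b‖ * ‖k * star b‖ ≤ (t ^ 2)⁻¹ := by
      rw [← CStarRing.norm_self_mul_star]
      have e : k * star b * star (k * star b) = cfc (fun x => f x * id x * f x) h := by
        rw [cfc_mul (fun x => f x * id x) f h (cf.mul continuous_id).continuousOn cf.continuousOn,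
          cfc_mul f id h cf.continuousOn continuousOn_id, cfc_id ℝ h, star_mul, star_star,
          hk.star_eq, hh]
        simp only [mul_assoc, k, hh]
      rw [e]
      refine norm_cfc_le (by positivity) fun x _ => ?_
      simp only [f, id, norm_mul, Real.norm_eq_abs, abs_inv, abs_of_pos (hmax x)]
      have h2 : (max |x| (t ^ 2))⁻¹ * |x| ≤ 1 := by
        rw [inv_mul_le_one₀ (hmax x)]
        exact le_max_left _ _
      have h3 : (max |x| (t ^ 2))⁻¹ ≤ (t ^ 2)⁻¹ := inv_anti₀ hs0 (le_max_right _ _)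
      calc _ ≤ 1 * (t ^ 2)⁻¹ := by gcongr
        _ = _ := one_mul _
    have h4 : ‖k * star b‖ ≤ t⁻¹ := by
      refine le_of_sq_le_sq ?_ (by positivity)
      rw [sq, inv_pow]
      exact h1
    calc _ ≤ ‖k * star b‖ * r := norm_mul_le _ _
      _ ≤ t⁻¹ * r := by gcongr
      _ < 1 := by rw [inv_mul_lt_one₀ ht0]; exact hrt
  obtain ⟨v, hv⟩ := isUnit_one_sub_of_norm_lt_one hz
  -- modulo `I`, the invertible element `v` is `1 - f(h) h`, which `q = g(h)` annihilates
  have hqI : q ∈ I := by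
    have e : q * v = q * k * star b * w := by
      rw [hv, mul_sub, mul_sub, mul_one, mul_sub]
      nth_rw 1 [← hqkh]
      rw [hh]
      simp only [mul_assoc]
      abel
    rw [← v.mul_inv_cancel_right q, e]
    exact I.mul_mem_right _ (I.mul_mem_left _ hwI)
  have hq0 : q = 0 := by
    rw [← hp.mul_one q hqI hqS, ← hqkh, hh, mul_assoc, mul_assoc, mul_assoc, hbp]
    simp
  have hnorm : ‖h‖ ≤ t ^ 2 := by
    rw [← cfc_id ℝ h]
    refine norm_cfc_le hs0.le fun x hx => ?_
    have hx0 : 0 ≤ x := spectrum_star_mul_self_nonneg x hx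
    have h0 : cfc g h = cfc (fun _ => (0 : ℝ)) h := by
      rw [cfc_const_zero]; exact hq0
    have := (cfc_eq_cfc_iff_eqOn (ha := hsa) (hf := cg.continuousOn)).1 h0 hx
    simp only [g] at this
    rw [id, Real.norm_of_nonneg hx0]
    linarith [le_max_left (x - t ^ 2) 0]
  rw [hh, CStarRing.norm_star_mul_self, ← sq] at hnorm
  exact absurd (le_of_sq_le_sq hnorm ht0.le) (not_le.2 htb)

end IdealUnit

/-! ### Suprema of scaled seminorms -/

section ScaledSup

variable {A : Type u} [CStarAlgebra A]

/-- The extended seminorm `a ↦ sup_n ‖T_n a‖ / β(n)` of a sequence of linear maps. -/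
noncomputable def scaledSup (T : ℕ → A →ₗ[ℂ] A) (β : ℕ → ℝ) (a : A) : ℝ≥0∞ :=
  ⨆ n, ENNReal.ofReal (‖T n a‖ / β n)

variable {T : ℕ → A →ₗ[ℂ] A} {β : ℕ → ℝ}

theorem scaledSup_le_coe_iff (hβ : ∀ n, 0 < β n) {a : A} {c : ℝ≥0} :
    scaledSup T β a ≤ c ↔ ∀ n, ‖T n a‖ ≤ c * β n := by
  rw [scaledSup, iSup_le_iff]
  refine forall_congr' fun n => ?_
  rw [← ENNReal.ofReal_coe_nnreal, ENNReal.ofReal_le_ofReal_iff c.coe_nonneg, div_le_iff₀ (hβ n)]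

theorem scaledSup_add_le (hβ : ∀ n, 0 < β n) (a b : A) :
    scaledSup T β (a + b) ≤ scaledSup T β a + scaledSup T β b := by
  refine iSup_le fun n => ?_
  refine le_trans ?_ (add_le_add (le_iSup (fun n => ENNReal.ofReal (‖T n a‖ / β n)) n)
    (le_iSup (fun n => ENNReal.ofReal (‖T n b‖ / β n)) n))
  have := (hβ n).le
  rw [← ENNReal.ofReal_add (by positivity) (by positivity), ← add_div, map_add]
  exact ENNReal.ofReal_le_ofReal (div_le_div_of_nonneg_right (norm_add_le _ _) this)

theorem scaledSup_smul (z : ℂ) (a : A) : scaledSup T β (z • a) = ‖z‖ₑ * scaledSup T β a := by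
  rw [scaledSup, scaledSup, ENNReal.mul_iSup]
  refine iSup_congr fun n => ?_
  rw [map_smul, norm_smul, mul_div_assoc, ENNReal.ofReal_mul (norm_nonneg z), ofReal_norm]

theorem isClosed_scaledSup_le_one (hβ : ∀ n, 0 < β n) (hT : ∀ n, Continuous (T n)) :
    IsClosed {a | scaledSup T β a ≤ 1} := by
  have : {a | scaledSup T β a ≤ 1} = ⋂ n, {a | ‖T n a‖ ≤ 1 * β n} := by
    ext a
    simp only [Set.mem_iInter, Set.mem_ofPred_eq, ← ENNReal.coe_one, scaledSup_le_coe_iff hβ,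
      NNReal.coe_one]
  rw [this]
  exact isClosed_iInter fun n => isClosed_le (hT n).norm continuous_const

/-- The seminorm is finite at the elements that are killed by all but finitely many of the maps. -/
theorem scaledSup_ne_top_of_forall_ge {a : A} {N : ℕ} (h : ∀ n, N ≤ n → T n a = 0) :
    scaledSup T β a ≠ ⊤ := by
  have : scaledSup T β a ≤ ∑ n ∈ Finset.range N, ENNReal.ofReal (‖T n a‖ / β n) := by
    refine iSup_le fun n => ?_
    rcases lt_or_ge n N with hn | hn
    · exact Finset.single_le_sum (f := fun n => ENNReal.ofReal (‖T n a‖ / β n))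
        (fun _ _ => zero_le) (Finset.mem_range.2 hn)
    · simp [h n hn]
  exact ne_top_of_le_ne_top (by simp) this

end ScaledSup

/-! ### Filtrations and the approximate identity of the ideal -/

section Filtration

variable {A : Type u} [CStarAlgebra A]

/-- An increasing sequence of finite-dimensional *-subalgebras of `A` that starts with the scalars
and has dense union, together with a faithful tracial state of `A`. -/
structure IsAFFiltration (S : ℕ → StarSubalgebra ℂ A) (τ : WeakDual ℂ A) : Prop where
  finiteDimensional : ∀ n, FiniteDimensional ℂ (S n)
  mono : Monotone S
  zero : S 0 = ⊥
  dense : Dense (⋃ n, (S n : Set A))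
  trace : IsFaithfulTracialState τ

namespace IsAFFiltration

variable {S : ℕ → StarSubalgebra ℂ A} {τ : WeakDual ℂ A}

theorem isPreservingCondExp (hS : IsAFFiltration S τ) (n : ℕ) :
    IsPreservingCondExp τ (S n) (condExp τ (S n)) :=
  have := hS.finiteDimensional n
  (condExp_spec hS.trace (S n)).1

theorem condExp_star (hS : IsAFFiltration S τ) (n : ℕ) (a : A) :
    condExp τ (S n) (star a) = star (condExp τ (S n) a) :=
  have := hS.finiteDimensional n
  (condExp_spec hS.trace (S n)).2.2 a

theorem condExp_mem (hS : IsAFFiltration S τ) (n : ℕ) (a : A) : condExp τ (S n) a ∈ S n :=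
  (hS.isPreservingCondExp n).mem a

theorem condExp_of_mem (hS : IsAFFiltration S τ) {n : ℕ} {a : A} (ha : a ∈ S n) :
    condExp τ (S n) a = a :=
  (hS.isPreservingCondExp n).apply_of_mem a ha

theorem norm_condExp_le (hS : IsAFFiltration S τ) (n : ℕ) (a : A) : ‖condExp τ (S n) a‖ ≤ ‖a‖ :=
  (hS.isPreservingCondExp n).norm_le a

theorem continuous_condExp (hS : IsAFFiltration S τ) (n : ℕ) : Continuous (condExp τ (S n)) :=
  AddMonoidHomClass.continuous_of_bound _ 1 fun a => by
    rw [one_mul]; exact hS.norm_condExp_le n a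

theorem condExp_mul_right (hS : IsAFFiltration S τ) {n : ℕ} {s : A} (hs : s ∈ S n) (a : A) :
    condExp τ (S n) (a * s) = condExp τ (S n) a * s := by
  simpa using (hS.isPreservingCondExp n).bimodule 1 (one_mem _) s hs a

theorem condExp_condExp (hS : IsAFFiltration S τ) {m n : ℕ} (hmn : m ≤ n) (a : A) :
    condExp τ (S m) (condExp τ (S n) a) = condExp τ (S m) a :=
  hS.trace.eq_of_forall_mul (hS.condExp_mem m _) (hS.condExp_mem m _) fun s hs => by
    rw [(hS.isPreservingCondExp m).apply_mul hs, (hS.isPreservingCondExp m).apply_mul hs,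
      (hS.isPreservingCondExp n).apply_mul (hS.mono hmn hs)]

/-- The conditional expectation is a best approximation up to a factor `2`. -/
theorem norm_sub_condExp_le (hS : IsAFFiltration S τ) {n : ℕ} {s : A} (hs : s ∈ S n) (a : A) :
    ‖a - condExp τ (S n) a‖ ≤ 2 * ‖a - s‖ := by
  have e : a - condExp τ (S n) a = (a - s) - condExp τ (S n) (a - s) := by
    rw [map_sub, hS.condExp_of_mem hs]; abel
  rw [e]
  refine (norm_sub_le _ _).trans ?_
  linarith [hS.norm_condExp_le n (a - s)]

theorem condExp_zero (hS : IsAFFiltration S τ) (a : A) :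
    condExp τ (S 0) a = τ a • (1 : A) := by
  have h := hS.condExp_mem 0 a
  rw [hS.zero, StarSubalgebra.mem_bot] at h
  obtain ⟨c, hc⟩ := h
  have h1 := (hS.isPreservingCondExp 0).preserving a
  rw [hS.zero] at h1 ⊢
  rw [← hc, Algebra.algebraMap_eq_smul_one, map_smul, hS.trace.state.1, smul_eq_mul, mul_one] at h1
  rw [← hc, h1, Algebra.algebraMap_eq_smul_one]

theorem exists_norm_sub_lt (hS : IsAFFiltration S τ) (a : A) {ε : ℝ} (hε : 0 < ε) :
    ∃ n, ∃ s ∈ S n, ‖a - s‖ < ε := by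
  obtain ⟨s, hs, h⟩ := Metric.dense_iff.1 hS.dense a ε hε
  rw [mem_ball_iff_norm'] at hs
  obtain ⟨n, hn⟩ := Set.mem_iUnion.1 h
  exact ⟨n, s, hn, hs⟩

theorem isIdealUnit (hS : IsAFFiltration S τ) (I : Ideal A) [I.IsTwoSided] (n : ℕ) :
    IsIdealUnit I (S n) (idealUnit I (S n)) :=
  have := hS.finiteDimensional n
  idealUnit_spec hS.trace (S n) I

theorem idealUnit_mem (hS : IsAFFiltration S τ) (I : Ideal A) [I.IsTwoSided] {m n : ℕ}
    (hmn : m ≤ n) : idealUnit I (S m) ∈ S n :=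
  hS.mono hmn (hS.isIdealUnit I m).mem_subalgebra

theorem idealUnit_mul_idealUnit (hS : IsAFFiltration S τ) (I : Ideal A) [I.IsTwoSided] {m n : ℕ}
    (hmn : m ≤ n) : idealUnit I (S m) * idealUnit I (S n) = idealUnit I (S m) :=
  (hS.isIdealUnit I n).mul_one _ (hS.isIdealUnit I m).mem_ideal (hS.idealUnit_mem I hmn)

theorem exists_mem_ideal_norm_sub_lt (hS : IsAFFiltration S τ) (I : Ideal A) [I.IsTwoSided]
    {ω : A} (hω : ω ∈ I) {ε : ℝ} (hε : 0 < ε) : ∃ n, ∃ s ∈ S n, s ∈ I ∧ ‖ω - s‖ < ε := by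
  obtain ⟨n, s, hs, h⟩ := hS.exists_norm_sub_lt ω (half_pos hε)
  have := hS.finiteDimensional n
  have hp := hS.isIdealUnit I n
  refine ⟨n, s * idealUnit I (S n), mul_mem hs hp.mem_subalgebra, I.mul_mem_left _ hp.mem_ideal,
    ?_⟩
  have h1 := norm_sub_mul_idealUnit_le hp hs hω
  rw [norm_sub_rev s ω] at h1
  calc ‖ω - s * idealUnit I (S n)‖ = ‖(ω - s) + (s - s * idealUnit I (S n))‖ := by
        rw [sub_add_sub_cancel]
    _ ≤ _ := norm_add_le _ _
    _ < ε := by linarith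

theorem tendsto_mul_idealUnit (hS : IsAFFiltration S τ) (I : Ideal A) [I.IsTwoSided]
    {ω : A} (hω : ω ∈ I) :
    Tendsto (fun n => ω * idealUnit I (S n)) atTop (𝓝 ω) ∧
      Tendsto (fun n => idealUnit I (S n) * ω) atTop (𝓝 ω) := by
  have key : ∀ ε > 0, ∃ N, ∀ n ≥ N, ∃ s, ‖ω - s‖ < ε ∧ s * idealUnit I (S n) = s ∧
      idealUnit I (S n) * s = s := by
    intro ε hε
    obtain ⟨N, s, hs, hsI, h⟩ := hS.exists_mem_ideal_norm_sub_lt I hω hε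
    exact ⟨N, fun n hn => ⟨s, h, (hS.isIdealUnit I n).mul_one s hsI (hS.mono hn hs),
      (hS.isIdealUnit I n).one_mul s hsI (hS.mono hn hs)⟩⟩
  constructor
  · refine Metric.tendsto_atTop.2 fun ε hε => ?_
    obtain ⟨N, hN⟩ := key ε hε
    refine ⟨N, fun n hn => ?_⟩
    obtain ⟨s, hs, h1, -⟩ := hN n hn
    rw [dist_comm, dist_eq_norm]
    have e : ω - ω * idealUnit I (S n) = (ω - s) * (1 - idealUnit I (S n)) := by
      rw [mul_sub, mul_one, sub_mul, h1]; abel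
    rw [e]
    exact ((norm_mul_le _ _).trans (mul_le_of_le_one_right (norm_nonneg _)
      (hS.isIdealUnit I n).norm_one_sub_le)).trans_lt hs
  · refine Metric.tendsto_atTop.2 fun ε hε => ?_
    obtain ⟨N, hN⟩ := key ε hε
    refine ⟨N, fun n hn => ?_⟩
    obtain ⟨s, hs, -, h1⟩ := hN n hn
    rw [dist_comm, dist_eq_norm]
    have e : ω - idealUnit I (S n) * ω = (1 - idealUnit I (S n)) * (ω - s) := by
      rw [sub_mul, one_mul, mul_sub, h1]; abel
    rw [e]
    exact ((norm_mul_le _ _).trans (mul_le_of_le_one_left (norm_nonneg _)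
      (hS.isIdealUnit I n).norm_one_sub_le)).trans_lt hs

end IsAFFiltration

end Filtration

/-! ### The seminorm `L_β` -/

section LipschitzSeminorm

variable {A : Type u} [CStarAlgebra A] {S : ℕ → StarSubalgebra ℂ A} {τ : WeakDual ℂ A} {β : ℕ → ℝ}

theorem Lβ_eq_scaledSup (a : A) :
    Lβ S τ β a = scaledSup (fun n => LinearMap.id - condExp τ (S n)) β a := rfl

theorem Lβ_le_coe_iff (hβ : ∀ n, 0 < β n) {a : A} {c : ℝ≥0} :
    Lβ S τ β a ≤ c ↔ ∀ n, ‖a - condExp τ (S n) a‖ ≤ c * β n := by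
  rw [Lβ_eq_scaledSup, scaledSup_le_coe_iff hβ]
  simp only [LinearMap.sub_apply, LinearMap.id_apply]

theorem Lβ_le_one_iff (hβ : ∀ n, 0 < β n) {a : A} :
    Lβ S τ β a ≤ 1 ↔ ∀ n, ‖a - condExp τ (S n) a‖ ≤ β n := by
  rw [← ENNReal.coe_one, Lβ_le_coe_iff hβ]
  simp

theorem Lβ_add_le (hβ : ∀ n, 0 < β n) (a b : A) :
    Lβ S τ β (a + b) ≤ Lβ S τ β a + Lβ S τ β b := by
  simpa only [Lβ_eq_scaledSup] using scaledSup_add_le hβ a b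

theorem Lβ_smul (z : ℂ) (a : A) : Lβ S τ β (z • a) = ‖z‖ₑ * Lβ S τ β a := by
  simp only [Lβ_eq_scaledSup, scaledSup_smul]

namespace IsAFFiltration

theorem isClosed_Lβ_le_one (hS : IsAFFiltration S τ) (hβ : ∀ n, 0 < β n) :
    IsClosed {a : A | Lβ S τ β a ≤ 1} := by
  simp only [Lβ_eq_scaledSup]
  exact isClosed_scaledSup_le_one hβ fun n => continuous_id.sub (hS.continuous_condExp n)

theorem Lβ_ne_top_of_mem (hS : IsAFFiltration S τ) {n : ℕ} {a : A} (ha : a ∈ S n) :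
    Lβ S τ β a ≠ ⊤ := by
  rw [Lβ_eq_scaledSup]
  refine scaledSup_ne_top_of_forall_ge (N := n) fun m hm => ?_
  rw [LinearMap.sub_apply, LinearMap.id_apply, hS.condExp_of_mem (hS.mono hm ha), sub_self]

theorem Lβ_star (hS : IsAFFiltration S τ) (a : A) : Lβ S τ β (star a) = Lβ S τ β a := by
  refine iSup_congr fun n => ?_
  rw [hS.condExp_star, ← star_sub, norm_star]

theorem Lβ_realPart_le (hS : IsAFFiltration S τ) (hβ : ∀ n, 0 < β n) (a : A) :
    Lβ S τ β (ℜ a : A) ≤ Lβ S τ β a := by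
  have e : (ℜ a : A) = (2⁻¹ : ℂ) • (a + star a) := by
    rw [realPart_apply_coe, ← Complex.coe_smul]; simp
  rw [e, Lβ_smul]
  calc _ ≤ ‖(2⁻¹ : ℂ)‖ₑ * (Lβ S τ β a + Lβ S τ β a) := by
        gcongr
        exact (Lβ_add_le hβ _ _).trans (by rw [hS.Lβ_star])
    _ = Lβ S τ β a := by
        rw [← two_mul, ← mul_assoc]
        have : ‖(2⁻¹ : ℂ)‖ₑ * 2 = 1 := by
          rw [show (2 : ℝ≥0∞) = ‖(2 : ℂ)‖ₑ by simp [enorm_eq_nnnorm], ← enorm_mul]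
          norm_num
        rw [this, one_mul]

theorem Lβ_imaginaryPart_le (hS : IsAFFiltration S τ) (hβ : ∀ n, 0 < β n) (a : A) :
    Lβ S τ β (ℑ a : A) ≤ Lβ S τ β a := by
  have e : (ℑ a : A) = (ℜ (-Complex.I • a) : A) := by
    rw [neg_smul, map_neg, realPart_I_smul, neg_neg]
  rw [e]
  refine (hS.Lβ_realPart_le hβ _).trans ?_
  rw [Lβ_smul]
  simp [enorm_eq_nnnorm]

/-- The quasi-Leibniz inequality: `E_n(a) E_n(b)` is an approximation of `a b` from `A_n`, and
`E_n(a b)` is a best one up to a factor `2`. -/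
theorem Lβ_mul_le (hS : IsAFFiltration S τ) (hβ : ∀ n, 0 < β n) {a b : A} {x y : ℝ≥0}
    (hx : Lβ S τ β a ≤ x) (hy : Lβ S τ β b ≤ y) : Lβ S τ β (a * b) ≤ F₂ ‖a‖₊ ‖b‖₊ x y := by
  rw [Lβ_le_coe_iff hβ] at hx hy ⊢
  intro n
  have hb := (hβ n).le
  refine (hS.norm_sub_condExp_le (mul_mem (hS.condExp_mem n a) (hS.condExp_mem n b)) _).trans ?_
  have e : a * b - condExp τ (S n) a * condExp τ (S n) b
      = (a - condExp τ (S n) a) * b + condExp τ (S n) a * (b - condExp τ (S n) b) := by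
    noncomm_ring
  have h : ‖a * b - condExp τ (S n) a * condExp τ (S n) b‖ ≤ x * β n * ‖b‖ + ‖a‖ * (y * β n) := by
    rw [e]
    refine (norm_add_le _ _).trans (add_le_add ?_ ?_)
    · exact (norm_mul_le _ _).trans (mul_le_mul_of_nonneg_right (hx n) (norm_nonneg _))
    · exact (norm_mul_le _ _).trans (mul_le_mul (hS.norm_condExp_le n a) (hy n) (norm_nonneg _)
        (norm_nonneg _))
  simp only [F₂, NNReal.coe_mul, NNReal.coe_add, coe_nnnorm, NNReal.coe_ofNat]
  linarith

/-- Bounded sets on which the seminorm is bounded are compact, since `E_n` approximates the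
identity uniformly on them. -/
theorem isCompact_Lβ_le_one (hS : IsAFFiltration S τ) (hβ : ∀ n, 0 < β n)
    (hβ0 : Tendsto β atTop (𝓝 0)) (R : ℝ) :
    IsCompact {a : A | Lβ S τ β a ≤ 1 ∧ ‖a‖ ≤ R} := by
  have hclosed : IsClosed {a : A | Lβ S τ β a ≤ 1 ∧ ‖a‖ ≤ R} :=
    (hS.isClosed_Lβ_le_one hβ).inter (isClosed_le continuous_norm continuous_const)
  refine isCompact_iff_totallyBounded_isComplete.2
    ⟨Metric.totallyBounded_iff.2 fun ε hε => ?_, hclosed.isComplete⟩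
  obtain ⟨n, hn⟩ := (hβ0.eventually_lt_const (half_pos hε)).exists
  have := hS.finiteDimensional n
  have : ProperSpace (S n) := FiniteDimensional.proper ℂ (S n)
  have hC : IsCompact ((fun s : S n => (s : A)) '' Metric.closedBall 0 R) :=
    (isCompact_closedBall 0 R).image continuous_subtype_val
  obtain ⟨t, ht, hct⟩ := Metric.totallyBounded_iff.1 hC.totallyBounded (ε / 2) (half_pos hε)
  refine ⟨t, ht, fun a ha => ?_⟩
  have h1 : condExp τ (S n) a ∈ (fun s : S n => (s : A)) '' Metric.closedBall 0 R :=
    ⟨⟨_, hS.condExp_mem n a⟩, mem_closedBall_zero_iff.2 ((hS.norm_condExp_le n a).trans ha.2), rfl⟩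
  obtain ⟨y, hy, hay⟩ := Set.mem_iUnion₂.1 (hct h1)
  refine Set.mem_iUnion₂.2 ⟨y, hy, ?_⟩
  have h2 := (Lβ_le_one_iff hβ).1 ha.1 n
  rw [mem_ball_iff_norm] at hay ⊢
  calc ‖a - y‖ = ‖(a - condExp τ (S n) a) + (condExp τ (S n) a - y)‖ := by
        rw [sub_add_sub_cancel]
    _ ≤ _ := norm_add_le _ _
    _ < ε := by linarith

theorem Lβ_eq_zero_iff (hS : IsAFFiltration S τ) (hβ : ∀ n, 0 < β n) (a : A) :
    Lβ S τ β a = 0 ↔ a = τ a • (1 : A) := by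
  rw [← nonpos_iff_eq_zero, ← ENNReal.coe_zero, Lβ_le_coe_iff hβ, ← hS.condExp_zero]
  constructor
  · intro h
    have := h 0
    rw [NNReal.coe_zero, zero_mul, norm_le_zero_iff, sub_eq_zero] at this
    exact this
  · intro h n
    have : a ∈ S n := hS.mono (Nat.zero_le n) (h ▸ hS.condExp_mem 0 a)
    rw [hS.condExp_of_mem this]
    simp

end IsAFFiltration

end LipschitzSeminorm

/-! ### The D-norm -/

section DNorm

variable {A : Type u} [CStarAlgebra A] {S : ℕ → StarSubalgebra ℂ A} {τ : WeakDual ℂ A} {β : ℕ → ℝ}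
  {I : Ideal A}

theorem DI_eq_max (ω : A) :
    DI S τ β I ω = max (max (Lβ S τ β ω) ‖ω‖ₑ)
      (scaledSup (fun n => LinearMap.id - LinearMap.mulRight ℂ (idealUnit I (S n))) β ω) := rfl

theorem DI_le_coe_iff (hβ : ∀ n, 0 < β n) {ω : A} {c : ℝ≥0} :
    DI S τ β I ω ≤ c ↔ (∀ n, ‖ω - condExp τ (S n) ω‖ ≤ c * β n) ∧ ‖ω‖ ≤ c ∧
      ∀ n, ‖ω - ω * idealUnit I (S n)‖ ≤ c * β n := by
  have h : ‖ω‖ₑ ≤ c ↔ ‖ω‖ ≤ c := by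
    rw [enorm_eq_nnnorm, ENNReal.coe_le_coe, ← NNReal.coe_le_coe, coe_nnnorm]
  rw [DI_eq_max, max_le_iff, max_le_iff, Lβ_le_coe_iff hβ, scaledSup_le_coe_iff hβ, h, and_assoc]
  simp only [LinearMap.sub_apply, LinearMap.id_apply, LinearMap.mulRight_apply]

theorem DI_le_one_iff (hβ : ∀ n, 0 < β n) {ω : A} :
    DI S τ β I ω ≤ 1 ↔ (∀ n, ‖ω - condExp τ (S n) ω‖ ≤ β n) ∧ ‖ω‖ ≤ 1 ∧
      ∀ n, ‖ω - ω * idealUnit I (S n)‖ ≤ β n := by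
  rw [← ENNReal.coe_one, DI_le_coe_iff hβ]
  simp

theorem DI_add_le (hβ : ∀ n, 0 < β n) (a b : A) :
    DI S τ β I (a + b) ≤ DI S τ β I a + DI S τ β I b := by
  simp only [DI_eq_max]
  refine max_le (max_le ((Lβ_add_le hβ a b).trans ?_) ((enorm_add_le a b).trans ?_))
    ((scaledSup_add_le hβ a b).trans ?_)
  · exact add_le_add (le_max_of_le_left (le_max_left _ _)) (le_max_of_le_left (le_max_left _ _))
  · exact add_le_add (le_max_of_le_left (le_max_right _ _)) (le_max_of_le_left (le_max_right _ _))
  · exact add_le_add (le_max_right _ _) (le_max_right _ _)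

theorem DI_smul (z : ℂ) (a : A) : DI S τ β I (z • a) = ‖z‖ₑ * DI S τ β I a := by
  have hm : Monotone fun x : ℝ≥0∞ => ‖z‖ₑ * x := fun x y h => mul_le_mul_right h _
  simp only [DI_eq_max]
  rw [hm.map_max, hm.map_max, Lβ_smul, enorm_smul, scaledSup_smul]

namespace IsAFFiltration

theorem isCompact_DI_le_one (hS : IsAFFiltration S τ) (hβ : ∀ n, 0 < β n)
    (hβ0 : Tendsto β atTop (𝓝 0)) : IsCompact {ω : A | DI S τ β I ω ≤ 1} := by
  have h1 := hS.isCompact_Lβ_le_one hβ hβ0 1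
  have h2 : IsClosed {ω : A |
      scaledSup (fun n => LinearMap.id - LinearMap.mulRight ℂ (idealUnit I (S n))) β ω ≤ 1} :=
    isClosed_scaledSup_le_one hβ fun n => continuous_id.sub (continuous_mul_const _)
  have e : {ω : A | DI S τ β I ω ≤ 1} = {a : A | Lβ S τ β a ≤ 1 ∧ ‖a‖ ≤ 1} ∩ {ω : A |
      scaledSup (fun n => LinearMap.id - LinearMap.mulRight ℂ (idealUnit I (S n))) β ω ≤ 1} := by
    ext ω
    simp only [Set.mem_ofPred_eq, Set.mem_inter_iff, DI_eq_max, max_le_iff]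
    rw [enorm_eq_nnnorm, ← ENNReal.coe_one, ENNReal.coe_le_coe, ← NNReal.coe_le_coe, coe_nnnorm,
      NNReal.coe_one, ENNReal.coe_one]
  rw [e]
  exact h1.inter_right h2

theorem DI_ne_top_of_mem [I.IsTwoSided] (hS : IsAFFiltration S τ) {n : ℕ} {ω : A}
    (hω : ω ∈ S n) (hI : ω ∈ I) :
    DI S τ β I ω ≠ ⊤ := by
  rw [DI_eq_max]
  have h := scaledSup_ne_top_of_forall_ge (β := β) (a := ω) (N := n)
    (T := fun n => LinearMap.id - LinearMap.mulRight ℂ (idealUnit I (S n))) fun m hm => by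
      rw [LinearMap.sub_apply, LinearMap.id_apply, LinearMap.mulRight_apply,
        (hS.isIdealUnit I m).mul_one ω hI (hS.mono hm hω), sub_self]
  exact (max_lt (max_lt (hS.Lβ_ne_top_of_mem hω).lt_top enorm_lt_top) h.lt_top).ne

theorem DI_mul_le (hS : IsAFFiltration S τ) (hβ : ∀ n, 0 < β n) {a ω : A} {x z : ℝ≥0}
    (hx : Lβ S τ β a ≤ x) (hz : DI S τ β I ω ≤ z) : DI S τ β I (a * ω) ≤ G₂ ‖a‖₊ x z := by
  have hz' := (DI_le_coe_iff hβ).1 hz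
  have hL : Lβ S τ β ω ≤ z := (Lβ_le_coe_iff hβ).2 hz'.1
  have hle : ‖a‖ * z ≤ (G₂ ‖a‖₊ x z : ℝ≥0) := by
    simp only [G₂, F₂, NNReal.coe_mul, NNReal.coe_add, coe_nnnorm, NNReal.coe_ofNat]
    have h1 : 0 ≤ ‖a‖ * z := by positivity
    have h2 : 0 ≤ (z : ℝ) * x := by positivity
    linarith
  refine (DI_le_coe_iff hβ).2 ⟨?_, ?_, fun n => ?_⟩
  · refine (Lβ_le_coe_iff hβ).1 ((hS.Lβ_mul_le hβ hx hL).trans (ENNReal.coe_le_coe.2 ?_))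
    have hn : ‖ω‖₊ ≤ z := hz'.2.1
    calc F₂ ‖a‖₊ ‖ω‖₊ x z ≤ 2 * (‖a‖₊ * z + z * x) := by simp only [F₂]; gcongr
      _ = G₂ ‖a‖₊ x z := by simp only [G₂, F₂, mul_comm z x]
  · exact ((norm_mul_le _ _).trans (mul_le_mul_of_nonneg_left hz'.2.1 (norm_nonneg _))).trans hle
  · rw [mul_assoc, ← mul_sub]
    refine ((norm_mul_le _ _).trans
      (mul_le_mul_of_nonneg_left (hz'.2.2 n) (norm_nonneg _))).trans ?_
    rw [← mul_assoc]
    exact mul_le_mul_of_nonneg_right hle (hβ n).le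

theorem Lβ_mul_star_le (hS : IsAFFiltration S τ) (hβ : ∀ n, 0 < β n) {ω ν : A} {x y : ℝ≥0}
    (hx : DI S τ β I ω ≤ x) (hy : DI S τ β I ν ≤ y) : Lβ S τ β (ω * star ν) ≤ H₂ x y := by
  have hx' := (DI_le_coe_iff hβ).1 hx
  have hy' := (DI_le_coe_iff hβ).1 hy
  refine (hS.Lβ_mul_le hβ ((Lβ_le_coe_iff hβ).2 hx'.1) (y := y) (by
    rw [hS.Lβ_star]; exact (Lβ_le_coe_iff hβ).2 hy'.1)).trans (ENNReal.coe_le_coe.2 ?_)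
  have h1 : ‖ω‖₊ ≤ x := hx'.2.1
  have h2 : ‖star ν‖₊ ≤ y := by rw [nnnorm_star]; exact hy'.2.1
  simp only [H₂, F₂]
  calc _ ≤ 2 * (x * y + y * x) := by gcongr
    _ = 2 * (x * y + x * y) := by rw [mul_comm y x]

end IsAFFiltration

end DNorm

/-! ### Quantum compact metric spaces -/

section QuantumMetricSpace

variable {A : Type u} [CStarAlgebra A] {S : ℕ → StarSubalgebra ℂ A} {τ : WeakDual ℂ A} {β : ℕ → ℝ}

/-- States are contractive: `|φ(x)|² ≤ φ(x* x) ≤ ‖x‖²`, by positivity at `x - φ(x)` and at a root of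
`‖x‖² - x* x`. -/
theorem norm_state_le {φ : WeakDual ℂ A} (hφ : φ ∈ stateSpace A) (x : A) : ‖φ x‖ ≤ ‖x‖ := by
  obtain ⟨c, hc⟩ := exists_sq_sub_eq_star_mul_self (le_refl ‖x‖)
  have h1 := hφ.2 c
  have h2 := hφ.2 (x - φ x • (1 : A))
  have e : star (x - φ x • (1 : A)) * (x - φ x • (1 : A))
      = star x * x - φ x • star x - star (φ x) • x + (star (φ x) * φ x) • (1 : A) := by
    simp only [star_sub, star_smul, star_one, mul_sub, sub_mul, smul_mul_assoc, mul_smul_comm,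
      one_mul, mul_one, smul_sub, smul_smul, mul_comm (star (φ x)) (φ x)]
    abel
  have e' : algebraMap ℝ A (‖x‖ ^ 2) = ((‖x‖ ^ 2 : ℝ) : ℂ) • (1 : A) := by
    rw [Algebra.algebraMap_eq_smul_one, Complex.coe_smul]
  rw [← hc, e', map_sub, map_smul, hφ.1] at h1
  rw [e, map_add, map_sub, map_sub, map_smul, map_smul, map_smul, hφ.1, state_star hφ] at h2
  have h3 := add_nonneg h1 h2
  have e2 : ((‖x‖ ^ 2 : ℝ) : ℂ) • (1 : ℂ) - φ (star x * x) + (φ (star x * x) - φ x • star (φ x)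
      - star (φ x) • φ x + (star (φ x) * φ x) • (1 : ℂ)) = ((‖x‖ ^ 2 - ‖φ x‖ ^ 2 : ℝ) : ℂ) := by
    have : star (φ x) * φ x = ((‖φ x‖ ^ 2 : ℝ) : ℂ) := by
      rw [Complex.star_def, Complex.conj_mul']; simp
    simp only [smul_eq_mul, mul_one, Complex.ofReal_sub, ← this]
    ring
  rw [e2, Complex.zero_le_real] at h3
  exact le_of_sq_le_sq (by linarith) (norm_nonneg x)

theorem enorm_complex_ofReal (r : ℝ) : ‖(r : ℂ)‖ₑ = ‖r‖ₑ := by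
  rw [← ofReal_norm, Complex.norm_real, ofReal_norm]

theorem map_realPart_coe {B : Type*} [CStarAlgebra B] (ι : B →⋆ₐ[ℂ] A) (b : B) :
    ι (ℜ b : B) = (ℜ (ι b) : A) := by
  simp only [realPart_apply_coe, ← Complex.coe_smul, map_smul, map_add, map_star]

theorem map_imaginaryPart_coe {B : Type*} [CStarAlgebra B] (ι : B →⋆ₐ[ℂ] A) (b : B) :
    ι (ℑ b : B) = (ℑ (ι b) : A) := by
  simp only [imaginaryPart_apply_coe, ← Complex.coe_smul, map_smul, map_sub, map_star]

theorem isAdmissible_F₂ : IsAdmissible F₂ where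
  mono x₁ x₂ x₃ x₄ y₁ y₂ y₃ y₄ h₁ h₂ h₃ h₄ := by
    simp only [F₂]
    gcongr
  leibniz_le x₁ x₂ x₃ x₄ := by
    simp only [F₂, two_mul]
    exact le_self_add

theorem isAdmissibleTriple : IsAdmissibleTriple F₂ G₂ H₂ where
  admissible := isAdmissible_F₂
  mono_G x y z x' y' z' hx hy hz := isAdmissible_F₂.mono _ _ _ _ _ _ _ _ hx hy hz hz
  le_G x y z := by
    rw [add_mul]
    exact isAdmissible_F₂.leibniz_le x y z z
  mono_H x y x' y' hx hy := isAdmissible_F₂.mono _ _ _ _ _ _ _ _ hx hx hy hy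
  le_H x y := by
    rw [mul_assoc, two_mul]
    exact isAdmissible_F₂.leibniz_le x x y y

theorem enorm_apply_sub_le_mul_mongeKantorovich {B : Type u} [CStarAlgebra B]
    {L : selfAdjoint B → ℝ≥0∞} (hL : ∀ (r : ℝ) (a), L (r • a) = ‖r‖ₑ * L a)
    {b : selfAdjoint B} {c : ℝ≥0} (hc : 0 < c) (hb : L b ≤ c) (φ ψ : WeakDual ℂ B) :
    ‖φ (b : B) - ψ (b : B)‖ₑ ≤ c * mongeKantorovich L φ ψ := by
  have hc0 : (c : ℝ≥0∞) ≠ 0 := by simpa using hc.ne'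
  have hinv : ‖((c⁻¹ : ℝ≥0) : ℝ)‖ₑ = (c : ℝ≥0∞)⁻¹ := by
    rw [enorm_eq_nnnorm, NNReal.nnnorm_eq, ENNReal.coe_inv hc.ne']
  have h1 : L (((c⁻¹ : ℝ≥0) : ℝ) • b) ≤ 1 := by
    rw [hL, hinv]
    calc _ ≤ (c : ℝ≥0∞)⁻¹ * c := by gcongr
      _ = 1 := ENNReal.inv_mul_cancel hc0 ENNReal.coe_ne_top
  have h2 : ‖φ ((((c⁻¹ : ℝ≥0) : ℝ) • b : selfAdjoint B) : B)
      - ψ ((((c⁻¹ : ℝ≥0) : ℝ) • b : selfAdjoint B) : B)‖ₑ ≤ mongeKantorovich L φ ψ :=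
    le_iSup₂ (f := fun (a : selfAdjoint B) (_ : L a ≤ 1) => ‖φ (a : B) - ψ (a : B)‖ₑ) _ h1
  rw [selfAdjoint.val_smul, ← Complex.coe_smul, map_smul, map_smul, ← smul_sub, enorm_smul,
    enorm_complex_ofReal, hinv] at h2
  calc ‖φ (b : B) - ψ (b : B)‖ₑ
      = c * ((c : ℝ≥0∞)⁻¹ * ‖φ (b : B) - ψ (b : B)‖ₑ) := by
        rw [← mul_assoc, ENNReal.mul_inv_cancel hc0 ENNReal.coe_ne_top, one_mul]
    _ ≤ _ := by gcongr

/-- If the domain of the seminorm is dense, then convergence of states in the Monge-Kantorovich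
distance implies weak* convergence: it gives convergence at the elements of finite seminorm, and
states are uniformly bounded. -/
theorem tendsto_of_tendsto_mongeKantorovich {B : Type u} [CStarAlgebra B]
    {L : selfAdjoint B → ℝ≥0∞} (hL : ∀ (r : ℝ) (a), L (r • a) = ‖r‖ₑ * L a)
    (hd : ∀ b : B, ∀ ε > 0, ∃ c : B, ‖b - c‖ < ε ∧ L (ℜ c) ≠ ⊤ ∧ L (ℑ c) ≠ ⊤)
    {φ : stateSpace B} {ψ : ℕ → stateSpace B}
    (h : Tendsto (fun n => mongeKantorovich L φ (ψ n)) atTop (𝓝 0)) :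
    Tendsto ψ atTop (𝓝 φ) := by
  have hsa : ∀ b : selfAdjoint B, L b ≠ ⊤ →
      Tendsto (fun n => (ψ n : WeakDual ℂ B) (b : B)) atTop (𝓝 ((φ : WeakDual ℂ B) (b : B))) := by
    intro b hb
    set c : ℝ≥0 := (L b).toNNReal + 1
    have hc : 0 < c := by positivity
    have hbc : L b ≤ c := by
      rw [← ENNReal.coe_toNNReal hb]
      exact ENNReal.coe_le_coe.2 (by simp [c])
    rw [tendsto_iff_edist_tendsto_0]
    have hlim : Tendsto (fun n => c * mongeKantorovich L φ (ψ n)) atTop (𝓝 0) := by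
      simpa using ENNReal.Tendsto.const_mul h (Or.inr (ENNReal.coe_ne_top (r := c)))
    refine tendsto_of_tendsto_of_tendsto_of_le_of_le tendsto_const_nhds hlim
      (fun _ => zero_le) fun n => ?_
    rw [edist_comm, edist_eq_enorm_sub]
    exact enorm_apply_sub_le_mul_mongeKantorovich hL hc hbc _ _
  rw [tendsto_subtype_rng]
  refine tendsto_iff_forall_eval_tendsto_topDualPairing.2 fun b => ?_
  change Tendsto (fun n => (ψ n : WeakDual ℂ B) b) atTop (𝓝 ((φ : WeakDual ℂ B) b))
  refine Metric.tendsto_atTop.2 fun ε hε => ?_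
  obtain ⟨c, hbc, hre, him⟩ := hd b (ε / 3) (by positivity)
  have hc : Tendsto (fun n => (ψ n : WeakDual ℂ B) c) atTop (𝓝 ((φ : WeakDual ℂ B) c)) := by
    have h1 := (hsa _ hre).add ((hsa _ him).const_smul Complex.I)
    have e : ∀ χ : WeakDual ℂ B, χ c = χ (ℜ c : B) + Complex.I • χ (ℑ c : B) := fun χ => by
      rw [← map_smul, ← map_add, realPart_add_I_smul_imaginaryPart]
    simpa only [← e] using h1
  obtain ⟨N, hN⟩ := Metric.tendsto_atTop.1 hc (ε / 3) (by positivity)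
  refine ⟨N, fun n hn => ?_⟩
  have h1 := norm_state_le (ψ n).2 (b - c)
  have h2 := norm_state_le φ.2 (b - c)
  have h3 := hN n hn
  rw [dist_eq_norm] at h3 ⊢
  have e : (ψ n : WeakDual ℂ B) b - (φ : WeakDual ℂ B) b
      = (ψ n : WeakDual ℂ B) (b - c) + ((ψ n : WeakDual ℂ B) c - (φ : WeakDual ℂ B) c)
        - (φ : WeakDual ℂ B) (b - c) := by
    rw [map_sub, map_sub]; ring
  rw [e]
  calc _ ≤ _ := norm_sub_le _ _
    _ ≤ ‖(ψ n : WeakDual ℂ B) (b - c)‖ + ‖(ψ n : WeakDual ℂ B) c - (φ : WeakDual ℂ B) c‖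
        + ‖(φ : WeakDual ℂ B) (b - c)‖ := add_le_add_left (norm_add_le _ _) _
    _ < ε := by linarith

/-- If the unit ball of the seminorm is totally bounded modulo scalars, then the Monge-Kantorovich
balls are weak* neighbourhoods: a state in the ball is controlled by finitely many values. -/
theorem eventually_mongeKantorovich_lt {B : Type u} [CStarAlgebra B]
    {L : selfAdjoint B → ℝ≥0∞}
    (hT : ∀ ε > 0, ∃ t : Set B, t.Finite ∧
      ∀ b : selfAdjoint B, L b ≤ 1 → ∃ z : ℂ, ∃ y ∈ t, ‖(b : B) - z • (1 : B) - y‖ < ε)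
    (φ : stateSpace B) {ε : ℝ≥0∞} (hε : 0 < ε) :
    ∀ᶠ ψ : stateSpace B in 𝓝 φ, mongeKantorovich L φ ψ < ε := by
  obtain ⟨r, hr0, hrε⟩ := ENNReal.lt_iff_exists_nnreal_btwn.1 hε
  have hr : 0 < (r : ℝ) := by exact_mod_cast hr0
  obtain ⟨t, ht, hcov⟩ := hT (r / 3) (by positivity)
  have hev : ∀ᶠ ψ : stateSpace B in 𝓝 φ, ∀ y ∈ t,
      ‖(φ : WeakDual ℂ B) y - (ψ : WeakDual ℂ B) y‖ < r / 3 := by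
    rw [Filter.eventually_all_finite ht]
    intro y _
    have hc : Continuous fun ψ : stateSpace B =>
        ‖(φ : WeakDual ℂ B) y - (ψ : WeakDual ℂ B) y‖ :=
      (continuous_const.sub ((WeakDual.eval_continuous y).comp continuous_subtype_val)).norm
    exact hc.continuousAt.eventually_lt continuousAt_const (by simpa using hr)
  filter_upwards [hev] with ψ hψ
  refine lt_of_le_of_lt (iSup₂_le fun b hb => ?_) hrε
  obtain ⟨z, y, hy, hby⟩ := hcov b hb
  rw [enorm_eq_nnnorm, ENNReal.coe_le_coe, ← NNReal.coe_le_coe, coe_nnnorm]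
  have h1 := norm_state_le φ.2 ((b : B) - z • (1 : B) - y)
  have h2 := norm_state_le ψ.2 ((b : B) - z • (1 : B) - y)
  have e : (φ : WeakDual ℂ B) (b : B) - (ψ : WeakDual ℂ B) (b : B)
      = (φ : WeakDual ℂ B) ((b : B) - z • (1 : B) - y)
        + ((φ : WeakDual ℂ B) y - (ψ : WeakDual ℂ B) y)
        - (ψ : WeakDual ℂ B) ((b : B) - z • (1 : B) - y) := by
    simp only [map_sub, map_smul, φ.2.1, ψ.2.1]; ring
  rw [e]
  have h3 := hψ y hy
  calc _ ≤ _ := norm_sub_le _ _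
    _ ≤ ‖(φ : WeakDual ℂ B) ((b : B) - z • (1 : B) - y)‖
        + ‖(φ : WeakDual ℂ B) y - (ψ : WeakDual ℂ B) y‖
        + ‖(ψ : WeakDual ℂ B) ((b : B) - z • (1 : B) - y)‖ := add_le_add_left (norm_add_le _ _) _
    _ ≤ r := by linarith

namespace IsAFFiltration

theorem Lβ_sub_condExp_zero (hS : IsAFFiltration S τ) (a : A) :
    Lβ S τ β (a - condExp τ (S 0) a) = Lβ S τ β a := by
  refine iSup_congr fun n => ?_
  rw [map_sub, hS.condExp_of_mem (hS.mono (Nat.zero_le n) (hS.condExp_mem 0 a)),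
    sub_sub_sub_cancel_right]

theorem isQuantumCompactMetricSpace (hS : IsAFFiltration S τ) (hβ : ∀ n, 0 < β n)
    (hβ0 : Tendsto β atTop (𝓝 0)) {B : Type u} [CStarAlgebra B] (ι : B →⋆ₐ[ℂ] A)
    (hι : Function.Injective ι) {L : selfAdjoint B → ℝ≥0∞}
    (hL : ∀ b : selfAdjoint B, L b = Lβ S τ β (ι b))
    (hd : ∀ b : B, ∀ ε > 0, ∃ c, ‖b - c‖ < ε ∧ ∃ n, ι c ∈ S n) :
    IsQuantumCompactMetricSpace F₂ L := by
  have hiso : Isometry ι := NonUnitalStarAlgHom.isometry ι hι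
  have hnorm : ∀ b, ‖ι b‖ = ‖b‖ := NonUnitalStarAlgHom.norm_map ι hι
  have hnn : ∀ b, ‖ι b‖₊ = ‖b‖₊ := NonUnitalStarAlgHom.nnnorm_map ι hι
  have hsmul : ∀ (r : ℝ) (a), L (r • a) = ‖r‖ₑ * L a := fun r a => by
    rw [hL, hL, selfAdjoint.val_smul, ← Complex.coe_smul, map_smul, Lβ_smul, enorm_complex_ofReal]
  have hred : ∀ b ε, 0 < ε → ∃ c : B, ‖b - c‖ < ε ∧ L (ℜ c) ≠ ⊤ ∧ L (ℑ c) ≠ ⊤ := by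
    intro b ε hε
    obtain ⟨c, hc, n, hn⟩ := hd b ε hε
    refine ⟨c, hc, ?_, ?_⟩
    · rw [hL, map_realPart_coe]
      exact ne_top_of_le_ne_top (hS.Lβ_ne_top_of_mem hn) (hS.Lβ_realPart_le hβ _)
    · rw [hL, map_imaginaryPart_coe]
      exact ne_top_of_le_ne_top (hS.Lβ_ne_top_of_mem hn) (hS.Lβ_imaginaryPart_le hβ _)
  -- subtracting the value of the trace moves the unit ball of the seminorm into a bounded set
  have hscal : ∀ b : selfAdjoint B, L b ≤ 1 →
      Lβ S τ β (ι ((b : B) - τ (ι b) • (1 : B))) ≤ 1 ∧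
        ‖ι ((b : B) - τ (ι b) • (1 : B))‖ ≤ β 0 := by
    intro b hb
    rw [hL] at hb
    rw [map_sub, map_smul, map_one, ← hS.condExp_zero, hS.Lβ_sub_condExp_zero]
    exact ⟨hb, (Lβ_le_one_iff hβ).1 hb 0⟩
  have hTB : ∀ ε > 0, ∃ t : Set B, t.Finite ∧
      ∀ b : selfAdjoint B, L b ≤ 1 → ∃ z : ℂ, ∃ y ∈ t, ‖(b : B) - z • (1 : B) - y‖ < ε := by
    intro ε hε
    have hK := hiso.isClosedEmbedding.isCompact_preimage (hS.isCompact_Lβ_le_one hβ hβ0 (β 0))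
    obtain ⟨t, ht, hcov⟩ := Metric.totallyBounded_iff.1 hK.totallyBounded ε hε
    refine ⟨t, ht, fun b hb => ⟨τ (ι b), ?_⟩⟩
    obtain ⟨y, hy, hby⟩ := Set.mem_iUnion₂.1 (hcov (hscal b hb))
    exact ⟨y, hy, mem_ball_iff_norm.1 hby⟩
  refine ⟨isAdmissible_F₂, fun a b => ?_, hsmul, ?_, fun a => ?_, fun φ hφ ψ hψ => ?_, fun φ => ?_,
    ?_, fun a b ha hb => ?_⟩
  · rw [hL, hL, hL, AddSubgroup.coe_add, map_add]
    exact Lβ_add_le hβ _ _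
  · refine Metric.dense_iff.2 fun a ε hε => ?_
    obtain ⟨c, hc, hre, -⟩ := hred a ε hε
    refine ⟨ℜ c, ?_, hre⟩
    rw [mem_ball_iff_norm']
    have e : a - ℜ c = ℜ ((a : B) - c) := by
      rw [map_sub, selfAdjoint.realPart_coe]
    rw [e]
    exact (realPart.norm_le _).trans_lt hc
  · rw [hL, hS.Lβ_eq_zero_iff hβ]
    constructor
    · intro h
      have hstar : star (τ (ι a)) = τ (ι a) := by
        rw [← state_star hS.trace.state, ← map_star, a.2.star_eq]
      refine ⟨(τ (ι a)).re, hι ?_⟩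
      rw [Complex.conj_eq_iff_re.1 hstar, map_smul, map_one]
      exact h
    · rintro ⟨r, hr⟩
      rw [hr, map_smul, map_one, map_smul, hS.trace.state.1, smul_eq_mul, mul_one]
  · refine ne_top_of_le_ne_top (b := ENNReal.ofReal (β 0 + β 0)) ENNReal.ofReal_ne_top
      (iSup₂_le fun b hb => ?_)
    rw [← ofReal_norm]
    refine ENNReal.ofReal_le_ofReal ?_
    have h1 := (hscal b hb).2
    rw [hnorm] at h1
    have e : φ (b : B) - ψ (b : B)
        = φ ((b : B) - τ (ι b) • (1 : B)) - ψ ((b : B) - τ (ι b) • (1 : B)) := by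
      simp only [map_sub, map_smul, hφ.1, hψ.1]; ring
    rw [e]
    exact (norm_sub_le _ _).trans (add_le_add ((norm_state_le hφ _).trans h1)
      ((norm_state_le hψ _).trans h1))
  · refine ⟨fun t => ⟨fun ht => ?_, fun ⟨ε, hε, hsub⟩ => ?_⟩⟩
    · by_contra! hcon
      have hpos : ∀ n : ℕ, (0 : ℝ≥0∞) < ((n : ℝ≥0∞) + 1)⁻¹ := fun n =>
        ENNReal.inv_pos.2 (by simp)
      have hex : ∀ n : ℕ, ∃ ψ : stateSpace B,
          mongeKantorovich L φ ψ < ((n : ℝ≥0∞) + 1)⁻¹ ∧ ψ ∉ t := fun n =>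
        Set.not_subset.1 (hcon _ (hpos n))
      choose ψ hψ hψt using hex
      have hlim : Tendsto (fun n => mongeKantorovich L φ (ψ n)) atTop (𝓝 0) := by
        refine tendsto_of_tendsto_of_tendsto_of_le_of_le tendsto_const_nhds
          ENNReal.tendsto_inv_nat_nhds_zero (fun _ => zero_le) fun n => ?_
        exact (hψ n).le.trans (ENNReal.inv_le_inv.2 le_self_add)
      obtain ⟨n, hn⟩ := ((tendsto_of_tendsto_mongeKantorovich hsmul hred hlim).eventually ht).exists
      exact hψt n hn
    · exact Filter.mem_of_superset (eventually_mongeKantorovich_lt hTB φ hε) hsub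
  · simp only [hL]
    exact (hS.isClosed_Lβ_le_one hβ).preimage (hiso.continuous.comp continuous_subtype_val)
  · have h := hS.Lβ_mul_le hβ (a := ι a) (b := ι b) (x := (L a).toNNReal) (y := (L b).toNNReal)
      (by rw [← hL, ENNReal.coe_toNNReal ha]) (by rw [← hL, ENNReal.coe_toNNReal hb])
    rw [hnn, hnn, ← map_mul] at h
    refine max_le ?_ ?_
    · rw [hL, jordanProd, map_realPart_coe]
      exact (hS.Lβ_realPart_le hβ _).trans h
    · rw [hL, lieProd, map_imaginaryPart_coe]
      exact (hS.Lβ_imaginaryPart_le hβ _).trans h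

end IsAFFiltration

end QuantumMetricSpace

/-! ### The metrized quantum vector bundles -/

section Bundles

variable {A : Type u} [CStarAlgebra A] {S : ℕ → StarSubalgebra ℂ A} {τ : WeakDual ℂ A} {β : ℕ → ℝ}
  {I : Ideal A} [I.IsTwoSided]

namespace IsAFFiltration

/-- A bundle whose base embeds in `A` by `ι` and whose module is, by `k`, a closed left ideal of the
base that `ι` maps to `I` is metrized by the restrictions of `L_β` and `D_I` as soon as the elements
of the filtration are dense in the base and in the module. -/
theorem isMetrizedQuantumVectorBundle (hS : IsAFFiltration S τ) (hβ : ∀ n, 0 < β n)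
    (hβ0 : Tendsto β atTop (𝓝 0)) {Ω : BundleData.{u}} (ι : Ω.A →⋆ₐ[ℂ] A)
    (hι : Function.Injective ι) (k : Ω.M →ₗ[ℂ] Ω.A) (hk : ∀ (a : Ω.A) ω, k (a • ω) = a * k ω)
    (hnorm : ∀ ω, ‖k ω‖ = ‖ω‖) (hclosed : IsClosed (Set.range k))
    (hinner : ∀ ω ν, Ω.inner ω ν = k ω * star (k ν))
    (hL : ∀ b : selfAdjoint Ω.A, Ω.L b = Lβ S τ β (ι b))
    (hD : ∀ ω, Ω.D ω = DI S τ β I (ι (k ω)))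
    (hdA : ∀ b : Ω.A, ∀ ε > 0, ∃ c, ‖b - c‖ < ε ∧ ∃ n, ι c ∈ S n)
    (hdM : ∀ ω : Ω.M, ∀ ε > 0, ∃ ν, ‖ω - ν‖ < ε ∧ ι (k ν) ∈ I ∧ ∃ n, ι (k ν) ∈ S n) :
    IsMetrizedQuantumVectorBundle F₂ G₂ H₂ Ω := by
  have hιiso : Isometry ι := NonUnitalStarAlgHom.isometry ι hι
  have hnn : ∀ b, ‖ι b‖₊ = ‖b‖₊ := NonUnitalStarAlgHom.nnnorm_map ι hι
  have hkiso : Isometry k := AddMonoidHomClass.isometry_of_norm k hnorm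
  have hkemb : IsClosedEmbedding k := ⟨hkiso.isEmbedding, hclosed⟩
  refine ⟨isAdmissibleTriple, hS.isQuantumCompactMetricSpace hβ hβ0 ι hι hL hdA,
    ⟨fun z a ω => ?_, fun ω ω' ν => ?_, fun a ω ν => ?_, fun ω ν => ?_, fun ω => ?_, fun ω h => ?_,
      fun ω => ?_, ?_⟩, fun ω ν => ?_, fun z ω => ?_, ?_, fun ω => ?_, ?_, fun a ω ha hω => ?_,
    fun ω ν hω hν => ?_⟩
  · apply hkiso.injective
    rw [hk, map_smul, hk, smul_mul_assoc]
  · simp only [hinner, map_add, add_mul]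
  · simp only [hinner, hk, mul_assoc]
  · simp only [hinner, star_mul, star_star]
  · exact ⟨star (k ω), by rw [hinner, star_star]⟩
  · rw [hinner, CStarRing.mul_star_self_eq_zero_iff] at h
    exact hkiso.injective (by rw [h, map_zero])
  · rw [hinner, CStarRing.norm_self_mul_star, Real.sqrt_mul_self (norm_nonneg _), hnorm]
  · exact (completeSpace_iff_isComplete_range hkiso.isUniformInducing).2 hclosed.isComplete
  · simp only [hD, map_add]
    exact DI_add_le hβ _ _
  · simp only [hD, map_smul, DI_smul]
  · refine Metric.dense_iff.2 fun ω ε hε => ?_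
    obtain ⟨ν, hν, hI, n, hn⟩ := hdM ω ε hε
    refine ⟨ν, mem_ball_iff_norm'.2 hν, ?_⟩
    change Ω.D ν ≠ ⊤
    rw [hD]
    exact hS.DI_ne_top_of_mem hn hI
  · have h : ‖ω‖ₑ = ‖ι (k ω)‖ₑ := by
      rw [← ofReal_norm, ← ofReal_norm, NonUnitalStarAlgHom.norm_map ι hι, hnorm]
    rw [h, hD, DI_eq_max]
    exact le_max_of_le_left (le_max_right _ _)
  · simp only [hD]
    exact (hιiso.isClosedEmbedding.comp hkemb).isCompact_preimage
      (hS.isCompact_DI_le_one (I := I) hβ hβ0)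
  · have h := hS.DI_mul_le (I := I) hβ (a := ι a) (ω := ι (k ω)) (x := (Ω.L a).toNNReal)
      (z := (Ω.D ω).toNNReal) (by rw [← hL, ENNReal.coe_toNNReal ha])
      (by rw [← hD, ENNReal.coe_toNNReal hω])
    rwa [hnn, ← map_mul, ← hk, ← hD] at h
  · have h := hS.Lβ_mul_star_le (I := I) hβ (ω := ι (k ω)) (ν := ι (k ν))
      (x := (Ω.D ω).toNNReal) (y := (Ω.D ν).toNNReal) (by rw [← hD, ENNReal.coe_toNNReal hω])
      (by rw [← hD, ENNReal.coe_toNNReal hν])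
    rw [← map_star, ← map_mul, ← hinner] at h
    refine max_le ?_ ?_
    · rw [hL, map_realPart_coe]
      exact (hS.Lβ_realPart_le hβ _).trans h
    · rw [hL, map_imaginaryPart_coe]
      exact (hS.Lβ_imaginaryPart_le hβ _).trans h

theorem isMetrizedQuantumVectorBundle_idealBundle (hS : IsAFFiltration S τ) (hβ : ∀ n, 0 < β n)
    (hβ0 : Tendsto β atTop (𝓝 0)) (hI : IsClosed (I : Set A)) :
    IsMetrizedQuantumVectorBundle F₂ G₂ H₂ (idealBundle S τ β I) := by
  refine hS.isMetrizedQuantumVectorBundle (Ω := idealBundle S τ β I) (I := I) hβ hβ0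
    (StarAlgHom.id ℂ A) Function.injective_id
    { toFun := fun ω => ω.1, map_add' := fun _ _ => rfl, map_smul' := fun _ _ => rfl }
    (fun _ _ => rfl) (fun _ => rfl) ?_ (fun _ _ => rfl) (fun _ => rfl) (fun _ => rfl) ?_ ?_
  · have e : Set.range (fun ω : I => ω.1) = (I : Set A) := Subtype.range_coe
    rw [← e] at hI
    exact hI
  · intro b ε hε
    obtain ⟨n, s, hs, h⟩ := hS.exists_norm_sub_lt b hε
    exact ⟨s, h, n, hs⟩
  · intro ω ε hε
    obtain ⟨n, s, hs, hsI, h⟩ := hS.exists_mem_ideal_norm_sub_lt I ω.2 hε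
    exact ⟨⟨s, hsI⟩, h, hsI, n, hs⟩

theorem isMetrizedQuantumVectorBundle_finiteIdealBundle [∀ n, FiniteDimensional ℂ (S n)]
    (hS : IsAFFiltration S τ) (hβ : ∀ n, 0 < β n) (hβ0 : Tendsto β atTop (𝓝 0))
    (hI : IsClosed (I : Set A)) (n : ℕ) :
    IsMetrizedQuantumVectorBundle F₂ G₂ H₂ (finiteIdealBundle S τ β I n) := by
  refine hS.isMetrizedQuantumVectorBundle (Ω := finiteIdealBundle S τ β I n) (I := I) hβ hβ0
    (S n).subtype Subtype.val_injective
    { toFun := fun ω => ω.1, map_add' := fun _ _ => rfl, map_smul' := fun _ _ => rfl }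
    (fun _ _ => rfl) (fun _ => rfl) ?_ (fun _ _ => rfl) (fun _ => rfl) (fun _ => rfl) ?_ ?_
  · have e : Set.range (fun ω : (I.comap (S n).subtype : Ideal (S n)) => ω.1)
        = (fun s : S n => (s : A)) ⁻¹' (I : Set A) := Subtype.range_coe
    have h := hI.preimage (continuous_subtype_val (p := fun a => a ∈ S n))
    rw [← e] at h
    exact h
  · intro b ε hε
    refine ⟨b, ?_, n, b.2⟩
    rwa [sub_self, norm_zero]
  · intro ω ε hε
    refine ⟨ω, ?_, ω.2, n, ω.1.2⟩
    rwa [sub_self, norm_zero]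

end IsAFFiltration

end Bundles

/-! ### Approximation in the unit ball of the D-norm -/

section Approximation

variable {A : Type u} [CStarAlgebra A] {S : ℕ → StarSubalgebra ℂ A} {τ : WeakDual ℂ A} {β : ℕ → ℝ}
  {I : Ideal A}

theorem star_mul_self_mul_projection {q w c x : A} (hq : IsStarProjection q) (hw : w * q = w)
    (h : x - star w * w = star c * c) :
    star (c * q) * (c * q) = q * x * q - star w * w := by
  have hqs : star q = q := hq.isSelfAdjoint.star_eq
  have e : star (c * q) * (c * q) = q * (star c * c) * q := by
    rw [star_mul, hqs]; simp only [mul_assoc]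
  have hsw : q * star w = star w := by rw [← hqs, ← star_mul, hw]
  rw [e, ← h, mul_sub, sub_mul, ← mul_assoc q (star w), hsw, mul_assoc (star w), hw]

/-- The norm of a sum of elements with orthogonal ranges and orthogonal supports is at most any
common bound of their norms. -/
theorem norm_add_le_of_star_mul_eq_zero {p u v : A} (hp : IsStarProjection p) (hu : u * p = u)
    (hv : v * p = 0) (huv : star u * v = 0) {r : ℝ} (hur : ‖u‖ ≤ r) (hvr : ‖v‖ ≤ r) :
    ‖u + v‖ ≤ r := by
  have hr : 0 ≤ r := (norm_nonneg u).trans hur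
  obtain ⟨c, hc⟩ := exists_sq_sub_eq_star_mul_self hur
  obtain ⟨d, hd⟩ := exists_sq_sub_eq_star_mul_self hvr
  have hvu : star v * u = 0 := by rw [← star_star (star v * u), star_mul, star_star, huv, star_zero]
  have h1 := star_mul_self_mul_projection hp hu hc
  have h2 := star_mul_self_mul_projection hp.one_sub (w := v)
    (by rw [mul_sub, hv, mul_one, sub_zero]) hd
  have h3 : star (algebraMap ℝ A r) * algebraMap ℝ A r = algebraMap ℝ A (r ^ 2) := by
    rw [← algebraMap_star_comm, ← map_mul, star_trivial, sq]
  have h := norm_le_of_sub_eq_star_mul_self (x := u + v) (y := algebraMap ℝ A r) (c := c * p)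
    (d := d * (1 - p)) (by
      have h4 : ∀ q : A, IsStarProjection q →
          q * algebraMap ℝ A (r ^ 2) * q = algebraMap ℝ A (r ^ 2) * q := fun q hq => by
        rw [← Algebra.commutes, mul_assoc, hq.isIdempotentElem.eq]
      rw [h1, h2, h3, h4 p hp, h4 _ hp.one_sub, star_add, mul_add, add_mul, add_mul, huv, hvu]
      noncomm_ring)
  rcases subsingleton_or_nontrivial A with _ | _
  · rw [Subsingleton.elim (u + v) 0, norm_zero]
    exact hr
  · rwa [norm_algebraMap', Real.norm_of_nonneg hr] at h

namespace IsAFFiltration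

variable [I.IsTwoSided]

/-- Conditional expectation does not preserve the ideal, so `E_n(ω)` has to be cut down by the unit
`p` of `I ∩ A_n`, which increases `L_β`. With `b = β(n)` and `e = E_n(ω)`, the estimate of the
increase comes from `e p = (1 - b) e + (b e p - (1 - b) e (1 - p))`, where the last term has norm at
most `b` because `‖e (1 - p)‖ ≤ b`. -/
theorem DI_condExp_mul_idealUnit_le (hS : IsAFFiltration S τ) (hβ : ∀ n, 0 < β n) {n : ℕ}
    (hb : β n < 1) {s : ℝ≥0} (hs1 : 1 ≤ s) (hs : ∀ m < n, (1 - β n) * β m + 2 * β n ≤ s * β m)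
    {ω : A} (hω : DI S τ β I ω ≤ 1) :
    DI S τ β I (condExp τ (S n) ω * idealUnit I (S n)) ≤ s := by
  obtain ⟨hω1, hω2, hω3⟩ := (DI_le_one_iff hβ).1 hω
  have hp := hS.isIdealUnit I n
  set p := idealUnit I (S n)
  set e := condExp τ (S n) ω with he
  set b := β n
  have hb0 : 0 < b := hβ n
  have hs1' : (1 : ℝ) ≤ s := hs1
  have hmem : e ∈ S n := hS.condExp_mem n ω
  have hepS : e * p ∈ S n := mul_mem hmem hp.mem_subalgebra
  have hnorm : ‖e * p‖ ≤ 1 := ((norm_mul_le _ _).trans (mul_le_of_le_one_right (norm_nonneg _)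
    hp.norm_le)).trans ((hS.norm_condExp_le n ω).trans hω2)
  have hez : ‖e * (1 - p)‖ ≤ b := by
    rw [he, ← hS.condExp_mul_right (sub_mem (one_mem _) hp.mem_subalgebra), mul_sub, mul_one]
    exact (hS.norm_condExp_le n _).trans (hω3 n)
  have hsβ : ∀ m, β m ≤ s * β m := fun m => le_mul_of_one_le_left (hβ m).le hs1'
  refine (DI_le_coe_iff hβ).2 ⟨fun m => ?_, hnorm.trans hs1', fun m => ?_⟩
  · rcases le_or_gt n m with hnm | hmn
    · rw [hS.condExp_of_mem (hS.mono hnm hepS), sub_self, norm_zero]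
      exact (hβ m).le.trans (hsβ m)
    · refine le_trans ?_ (hs m hmn)
      set u : A := (b : ℂ) • (e * p)
      set v : A := -((1 - b : ℝ) : ℂ) • (e * (1 - p))
      have hepu : e * p = ((1 - b : ℝ) : ℂ) • e + (u + v) := by
        have : ((1 - b : ℝ) : ℂ) = 1 - (b : ℂ) := by push_cast; rfl
        simp only [u, v, this, mul_sub, mul_one, smul_sub, sub_smul, neg_smul, one_smul]
        abel
      have hpz : (1 - p) * p = 0 := by rw [sub_mul, one_mul, hp.mul_self, sub_self]
      have huv : ‖u + v‖ ≤ b := by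
        refine norm_add_le_of_star_mul_eq_zero hp.isStarProjection ?_ ?_ ?_ ?_ ?_
        · simp only [u, smul_mul_assoc, mul_assoc, hp.mul_self]
        · simp only [v, smul_mul_assoc, mul_assoc, hpz, mul_zero, smul_zero]
        · have : star (e * p) * (e * (1 - p)) = 0 := by
            have h1 : e * (1 - p) = (1 - p) * e := by
              rw [mul_sub, sub_mul, hp.commute hmem, mul_one, one_mul]
            have h2 : star (e * p) = star e * p := by
              rw [star_mul, hp.star_eq, hp.commute (star_mem hmem)]
            have h3 : p * (1 - p) = 0 := by rw [mul_sub, mul_one, hp.mul_self, sub_self]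
            rw [h1, h2, mul_assoc, ← mul_assoc p, h3, zero_mul, mul_zero]
          simp only [u, v, star_smul, smul_mul_smul_comm, this, smul_zero]
        · simp only [u, norm_smul, Complex.norm_real, Real.norm_of_nonneg hb0.le]
          exact mul_le_of_le_one_right hb0.le hnorm
        · simp only [v, norm_smul, norm_neg, Complex.norm_real,
            Real.norm_of_nonneg (sub_nonneg.2 hb.le)]
          exact (mul_le_of_le_one_left (norm_nonneg _) (by linarith)).trans hez
      have h1 : ‖e - condExp τ (S m) e‖ ≤ β m := by
        have : e - condExp τ (S m) e = condExp τ (S n) (ω - condExp τ (S m) ω) := by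
          rw [map_sub, hS.condExp_of_mem (hS.mono hmn.le (hS.condExp_mem m ω)), he,
            hS.condExp_condExp hmn.le]
        rw [this]
        exact (hS.norm_condExp_le n _).trans (hω1 m)
      have h2 : ‖(u + v) - condExp τ (S m) (u + v)‖ ≤ 2 * b := by
        have := hS.norm_sub_condExp_le (zero_mem (S m)) (u + v)
        rw [sub_zero] at this
        linarith
      rw [hepu, map_add, map_smul, add_sub_add_comm, ← smul_sub]
      refine (norm_add_le _ _).trans (add_le_add ?_ h2)
      rw [norm_smul, Complex.norm_real, Real.norm_of_nonneg (sub_nonneg.2 hb.le)]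
      exact mul_le_mul_of_nonneg_left h1 (sub_nonneg.2 hb.le)
  · refine le_trans ?_ (hsβ m)
    rcases le_or_gt n m with hnm | hmn
    · rw [mul_assoc, hS.idealUnit_mul_idealUnit I hnm, sub_self, norm_zero]
      exact (hβ m).le
    · have hq := hS.idealUnit_mem I hmn.le
      have h1 : p * idealUnit I (S m) = idealUnit I (S m) := by
        rw [hp.commute hq]
        exact hS.idealUnit_mul_idealUnit I hmn.le
      have h2 : e * p - e * p * idealUnit I (S m)
          = condExp τ (S n) ((ω - ω * idealUnit I (S m)) * p) := by
        rw [sub_mul, mul_assoc ω, hS.idealUnit_mul_idealUnit I hmn.le, map_sub,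
          hS.condExp_mul_right hp.mem_subalgebra, hS.condExp_mul_right hq, mul_assoc e, h1]
      rw [h2]
      exact ((hS.norm_condExp_le n _).trans ((norm_mul_le _ _).trans
        (mul_le_of_le_one_right (norm_nonneg _) hp.norm_le))).trans (hω3 m)

/-- The unit ball of `D_I` is approximated, for the modular Monge-Kantorovich distance, by the unit
ball of its restriction to `I ∩ A_n`. The parts of `ω` and `ξ` that the unit `p` of `I ∩ A_n` cuts
off contribute `β(n) ^ 2`; the rest is the error of a convex combination of the zero element and
`E_n(ω) p`, with weights that bring the D-norm down to `1`. -/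
theorem exists_norm_sub_mul_star_le (hS : IsAFFiltration S τ) (hβ : ∀ n, 0 < β n) {n : ℕ} {y : ℝ}
    (hb : β n < 1) (hby : β n ≤ y) (hy : ∀ m < n, 2 * β n ≤ y * β m)
    {ω : A} (hω : DI S τ β I ω ≤ 1) :
    ∃ η ∈ S n, η ∈ I ∧ DI S τ β I η ≤ 1 ∧
      ∀ ξ, DI S τ β I ξ ≤ 1 → ‖(ω - η) * star ξ‖ ≤ y / (1 + y - β n) + β n ^ 2 := by
  have hp := hS.isIdealUnit I n
  obtain ⟨hω1, hω2, hω3⟩ := (DI_le_one_iff hβ).1 hω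
  have hb0 := hβ n
  have hs0 : 1 ≤ 1 + y - β n := by linarith
  have hspos : 0 < 1 + y - β n := by linarith
  let s : ℝ≥0 := ⟨1 + y - β n, by linarith⟩
  have hs : (s : ℝ) = 1 + y - β n := rfl
  have hspos' : 0 < s := hspos
  have hDs : DI S τ β I (condExp τ (S n) ω * idealUnit I (S n)) ≤ s := by
    refine hS.DI_condExp_mul_idealUnit_le hβ hb hs0 (fun m hm => ?_) hω
    rw [hs]
    linarith [hy m hm]
  set p := idealUnit I (S n)
  set e := condExp τ (S n) ω
  have hmem : e * p ∈ S n := mul_mem (hS.condExp_mem n ω) hp.mem_subalgebra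
  refine ⟨(((s : ℝ)⁻¹ : ℝ) : ℂ) • (e * p), (S n).smul_mem hmem _, ?_, ?_, fun ξ hξ => ?_⟩
  · rw [← smul_mul_assoc]
    exact I.mul_mem_left _ hp.mem_ideal
  · rw [DI_smul, enorm_complex_ofReal, ← NNReal.coe_inv, enorm_eq_nnnorm, NNReal.nnnorm_eq,
      ENNReal.coe_inv hspos'.ne']
    calc _ ≤ (s : ℝ≥0∞)⁻¹ * s := by gcongr
      _ = 1 := ENNReal.inv_mul_cancel (by simpa using hspos'.ne') ENNReal.coe_ne_top
  · obtain ⟨-, hξ2, hξ3⟩ := (DI_le_one_iff hβ).1 hξ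
    have hz : (1 - p) * (1 - p) = 1 - p := hp.isStarProjection.one_sub.isIdempotentElem.eq
    have h1 : (ω - ω * p) * star ξ = (ω - ω * p) * star (ξ - ξ * p) := by
      have e1 : ω - ω * p = ω * (1 - p) := by rw [mul_sub, mul_one]
      have e2 : star (ξ - ξ * p) = (1 - p) * star ξ := by
        rw [star_sub, star_mul, hp.star_eq, sub_mul, one_mul]
      rw [e1, e2, mul_assoc, mul_assoc, ← mul_assoc (1 - p) (1 - p), hz]
    have h2 : ‖(ω - ω * p) * star ξ‖ ≤ β n ^ 2 := by
      rw [h1, sq]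
      exact (norm_mul_le _ _).trans (mul_le_mul (hω3 n) (by rw [norm_star]; exact hξ3 n)
        (norm_nonneg _) hb0.le)
    have h3 : ‖ω * p - e * p‖ ≤ β n := by
      rw [← sub_mul]
      exact ((norm_mul_le _ _).trans (mul_le_of_le_one_right (norm_nonneg _) hp.norm_le)).trans
        (hω1 n)
    have h4 : ‖ω * p‖ ≤ 1 :=
      ((norm_mul_le _ _).trans (mul_le_of_le_one_right (norm_nonneg _) hp.norm_le)).trans hω2
    have hinv1 : (s : ℝ)⁻¹ ≤ 1 := inv_le_one_of_one_le₀ hs0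
    have hinv0 : 0 ≤ (s : ℝ)⁻¹ := by positivity
    have h5 : ‖ω * p - (((s : ℝ)⁻¹ : ℝ) : ℂ) • (e * p)‖ ≤ y / (1 + y - β n) := by
      have e1 : ω * p - (((s : ℝ)⁻¹ : ℝ) : ℂ) • (e * p)
          = (((s : ℝ)⁻¹ : ℝ) : ℂ) • (ω * p - e * p) + ((1 - (s : ℝ)⁻¹ : ℝ) : ℂ) • (ω * p) := by
        rw [Complex.ofReal_sub, Complex.ofReal_one, sub_smul, one_smul, smul_sub]
        abel
      rw [e1]
      refine (norm_add_le _ _).trans ?_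
      rw [norm_smul, norm_smul, Complex.norm_real, Complex.norm_real, Real.norm_of_nonneg hinv0,
        Real.norm_of_nonneg (sub_nonneg.2 hinv1)]
      calc _ ≤ (s : ℝ)⁻¹ * β n + (1 - (s : ℝ)⁻¹) * 1 := by
            gcongr
        _ = y / (1 + y - β n) := by
            rw [hs]
            field_simp
            ring
    have e2 : (ω - (((s : ℝ)⁻¹ : ℝ) : ℂ) • (e * p)) * star ξ
        = (ω * p - (((s : ℝ)⁻¹ : ℝ) : ℂ) • (e * p)) * star ξ + (ω - ω * p) * star ξ := by
      rw [← add_mul]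
      congr 1
      abel
    rw [e2]
    refine (norm_add_le _ _).trans (add_le_add ?_ h2)
    refine (norm_mul_le _ _).trans (le_trans ?_ h5)
    exact mul_le_of_le_one_right (norm_nonneg _) (by rw [norm_star]; exact hξ2)

/-- The approximation by elements of `I ∩ A_n` within any admissible bound `r`. When `r` is at least
`1`, the zero element is a good enough approximation. -/
theorem exists_norm_sub_mul_star_le_of_bound (hS : IsAFFiltration S τ) (hβ : ∀ n, 0 < β n)
    {n : ℕ} {y r : ℝ} (hby : β n ≤ y) (hy : ∀ m < n, 2 * β n ≤ y * β m)
    (hr : 1 ≤ r ∨ β n < 1 ∧ y / (1 + y - β n) + β n ^ 2 ≤ r)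
    {ω : A} (hω : DI S τ β I ω ≤ 1) :
    ∃ η ∈ S n, η ∈ I ∧ DI S τ β I η ≤ 1 ∧
      ∀ ξ, DI S τ β I ξ ≤ 1 → ‖(ω - η) * star ξ‖ ≤ r := by
  rcases hr with hr | ⟨hb, hr⟩
  · refine ⟨0, zero_mem _, I.zero_mem, ?_, fun ξ hξ => ?_⟩
    · refine (DI_le_one_iff hβ).2 ⟨fun m => ?_, ?_, fun m => ?_⟩ <;> simp [(hβ _).le]
    · have h1 := ((DI_le_one_iff hβ).1 hω).2.1
      have h2 := ((DI_le_one_iff hβ).1 hξ).2.1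
      rw [sub_zero]
      refine ((norm_mul_le _ _).trans ?_).trans hr
      rw [norm_star]
      exact mul_le_one₀ h1 (norm_nonneg _) h2
  · obtain ⟨η, hηS, hηI, hη, h⟩ := hS.exists_norm_sub_mul_star_le hβ hb hby hy hω
    exact ⟨η, hηS, hηI, hη, fun ξ hξ => (h ξ hξ).trans hr⟩

end IsAFFiltration

end Approximation

/-! ### The sequence `x_n` -/

section Sequence

variable {β : ℕ → ℝ}

theorem le_xSeq_sub_one (n : ℕ) : β n ≤ xSeq β n - 1 := by
  have : 1 + β n ≤ xSeq β n := le_max_left _ _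
  linarith

theorem two_mul_le_xSeq_sub_one_mul (hβ : ∀ n, 0 < β n) {m n : ℕ} (hmn : m < n) :
    2 * β n ≤ (xSeq β n - 1) * β m := by
  have h : (2 * β n + β m) / β m ≤ xSeq β n :=
    (le_ciSup (f := fun m : Fin n => (2 * β n + β m) / β m) (Set.finite_range _).bddAbove
      ⟨m, hmn⟩).trans (le_max_right _ _)
  rw [div_le_iff₀ (hβ m)] at h
  linarith

/-- The tail of the maximum is controlled by the consecutive ratios, the rest by `β(n) → 0`. -/
theorem tendsto_max_xSeq (hβ : ∀ n, 0 < β n) (hβ0 : Tendsto β atTop (𝓝 0))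
    (hratio : Tendsto (fun n => β (n + 1) / β n) atTop (𝓝 0)) :
    Tendsto (fun n => max (β n) (xSeq β n - 1)) atTop (𝓝 0) := by
  refine Metric.tendsto_atTop.2 fun ε hε => ?_
  obtain ⟨δ, hδ0, hδ1, hδε⟩ : ∃ δ : ℝ, 0 < δ ∧ δ < 1 ∧ 2 * δ < ε :=
    ⟨min (1 / 2) (ε / 3), by positivity, by linarith [min_le_left (1 / 2 : ℝ) (ε / 3)],
      by linarith [min_le_right (1 / 2 : ℝ) (ε / 3)]⟩
  obtain ⟨N, hN⟩ := eventually_atTop.1 (hratio.eventually_lt_const hδ0)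
  have hstep : ∀ n ≥ N, β (n + 1) ≤ δ * β n := fun n hn => by
    have := hN n hn
    rw [div_lt_iff₀ (hβ n)] at this
    exact this.le
  have htail : ∀ m ≥ N, ∀ n > m, β n ≤ δ * β m := by
    intro m hm n hn
    induction n, hn using Nat.le_induction with
    | base => exact hstep m hm
    | succ n hn ih =>
      have h1 := hstep n (hm.trans (Nat.le_of_succ_le hn))
      have h2 := hβ n
      nlinarith
  have hhead : ∀ᶠ n in atTop, ∀ m ∈ Finset.range N, β n ≤ δ * β m := by
    rw [Filter.eventually_all_finset]
    intro m _
    filter_upwards [hβ0.eventually_lt_const (mul_pos hδ0 (hβ m))] with n hn using hn.le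
  obtain ⟨N', hN'⟩ := eventually_atTop.1 (hhead.and (hβ0.eventually_lt_const hδ0))
  refine ⟨N' + 1, fun n hn => ?_⟩
  obtain ⟨h1, h2⟩ := hN' n (by omega)
  have hall : ∀ m < n, β n ≤ δ * β m := fun m hm => by
    rcases lt_or_ge m N with h | h
    · exact h1 m (Finset.mem_range.2 h)
    · exact htail m h n hm
  have hn0 : 0 < n := by omega
  have : Nonempty (Fin n) := ⟨⟨0, hn0⟩⟩
  have hx : xSeq β n ≤ 1 + 2 * δ := by
    refine max_le (by linarith) (ciSup_le fun m => ?_)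
    rw [div_le_iff₀ (hβ m)]
    linarith [hall m m.2]
  have h0 := hβ n
  rw [Real.dist_0_eq_abs, abs_of_nonneg (le_max_of_le_left h0.le)]
  exact max_lt (by linarith) (by linarith)

end Sequence

/-! ### The bridge and its length -/

section Bridge

theorem hausdorff_le {X : Type*} {d : X → X → ℝ≥0∞} {s t : Set X} {r : ℝ≥0∞}
    (h₁ : ∀ x ∈ s, ∃ y ∈ t, d x y ≤ r) (h₂ : ∀ y ∈ t, ∃ x ∈ s, d x y ≤ r) :
    hausdorff d s t ≤ r := by
  refine max_le (iSup₂_le fun x hx => ?_) (iSup₂_le fun y hy => ?_)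
  · obtain ⟨y, hy, h⟩ := h₁ x hx
    exact (iInf₂_le y hy).trans h
  · obtain ⟨x, hx, h⟩ := h₂ y hy
    exact (iInf₂_le x hx).trans h

theorem mongeKantorovich_self {B : Type u} [CStarAlgebra B] (L : selfAdjoint B → ℝ≥0∞)
    (φ : WeakDual ℂ B) : mongeKantorovich L φ φ = 0 := by
  simp [mongeKantorovich]

theorem BundleData.modularMK_self (Ω : BundleData.{u}) (ω : Ω.M) : Ω.modularMK ω ω = 0 := by
  simp [BundleData.modularMK]

theorem enorm_le_ofReal {E : Type*} [NormedAddCommGroup E] {x : E} {r : ℝ} (h : ‖x‖ ≤ r) :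
    ‖x‖ₑ ≤ ENNReal.ofReal r := by
  rw [← ofReal_norm]
  exact ENNReal.ofReal_le_ofReal h

theorem levelSet_one {D : Type u} [CStarAlgebra D] : levelSet (1 : D) = stateSpace D := by
  ext φ
  simp [levelSet]

variable {A : Type u} [CStarAlgebra A] {S : ℕ → StarSubalgebra ℂ A} {τ : WeakDual ℂ A} {β : ℕ → ℝ}
  {I : Ideal A}

namespace IsAFFiltration

theorem nontrivial (hS : IsAFFiltration S τ) : Nontrivial A :=
  ⟨1, 0, fun h => by
    have := hS.trace.state.1
    rw [h, map_zero] at this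
    exact zero_ne_one this⟩

theorem Lβ_condExp_le_one (hS : IsAFFiltration S τ) (hβ : ∀ n, 0 < β n) {a : A}
    (ha : Lβ S τ β a ≤ 1) (n : ℕ) : Lβ S τ β (condExp τ (S n) a) ≤ 1 := by
  rw [Lβ_le_one_iff hβ] at ha ⊢
  intro m
  rcases le_or_gt n m with hnm | hmn
  · rw [hS.condExp_of_mem (hS.mono hnm (hS.condExp_mem n a)), sub_self, norm_zero]
    exact (hβ m).le
  · have e : condExp τ (S n) a - condExp τ (S m) (condExp τ (S n) a)
        = condExp τ (S n) (a - condExp τ (S m) a) := by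
      rw [map_sub, hS.condExp_of_mem (hS.mono hmn.le (hS.condExp_mem m a)),
        hS.condExp_condExp hmn.le]
    rw [e]
    exact (hS.norm_condExp_le n _).trans (ha m)

variable [∀ n, FiniteDimensional ℂ (S n)]

/-- Every state of `A_n` extends to `A`, by composition with the conditional expectation. -/
theorem exists_state_extension (hS : IsAFFiltration S τ) (n : ℕ) :
    let _ : CStarAlgebra (S n) := finDimCStarAlgebra (S n)
    ∀ φ ∈ stateSpace (S n), ∃ θ ∈ stateSpace A, ∀ a : S n, φ a = θ (a : A) := by
  intro _ φ hφ
  let P : A →ₗ[ℂ] S n :=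
    { toFun := fun a => ⟨condExp τ (S n) a, hS.condExp_mem n a⟩
      map_add' := fun a b => Subtype.ext (map_add _ a b)
      map_smul' := fun c a => Subtype.ext (map_smul _ c a) }
  have hP : ∀ a : S n, P (a : A) = a := fun a => Subtype.ext (hS.condExp_of_mem a.2)
  let P' : A →L[ℂ] S n := P.mkContinuous 1 fun a => by
    rw [one_mul]; exact hS.norm_condExp_le n a
  let θ : WeakDual ℂ A := (φ : S n →L[ℂ] ℂ).comp P'
  have hθ : ∀ a, θ a = φ (P a) := fun _ => rfl
  refine ⟨θ, ⟨?_, fun a => ?_⟩, fun a => ?_⟩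
  · rw [hθ]
    have := hP 1
    rw [OneMemClass.coe_one] at this
    rw [this]
    exact hφ.1
  · obtain ⟨b, hb, h⟩ := (condExp_spec hS.trace (S n)).2.1 a
    rw [hθ]
    have e : P (star a * a) = star (⟨b, hb⟩ : S n) * ⟨b, hb⟩ := Subtype.ext h
    rw [e]
    exact hφ.2 _
  · rw [hθ, hP]

/-- The bridge in `A` with pivot `1` whose anchors and co-anchors are the elements of the unit ball
of the D-norm of `I ∩ A_n`. -/
noncomputable def inclusionBridge (hS : IsAFFiltration S τ) (hβ : ∀ n, 0 < β n) (n : ℕ) :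
    ModularBridge (finiteIdealBundle S τ β I n) (idealBundle S τ β I) where
  D := A
  cstarAlgebra := inferInstance
  pivot := 1
  norm_pivot := by
    have := hS.nontrivial
    exact CStarRing.norm_one
  levelSet_nonempty := by
    rw [levelSet_one]
    exact ⟨τ, hS.trace.state⟩
  π₁ := (S n).subtype
  π₂ := StarAlgHom.id ℂ A
  injective₁ := Subtype.val_injective
  injective₂ := Function.injective_id
  J := (finiteIdealBundle S τ β I n).ball
  nonempty := ⟨⟨0, by
    change DI S τ β I (0 : A) ≤ 1
    refine (DI_le_one_iff hβ).2 ⟨fun m => ?_, ?_, fun m => ?_⟩ <;> simp [(hβ _).le]⟩⟩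
  anchor := fun j => j.1
  coanchor := fun j => ⟨(j.1.1 : A), j.1.2⟩
  anchor_mem := fun j => j.2
  coanchor_mem := fun j => j.2

theorem height_inclusionBridge (hS : IsAFFiltration S τ) (hβ : ∀ n, 0 < β n) (n : ℕ) :
    (hS.inclusionBridge (I := I) hβ n).height = 0 := by
  refine le_antisymm (max_le (hausdorff_le (fun φ hφ => ⟨φ, ⟨hφ, ?_⟩, ?_⟩) fun φ hφ =>
    ⟨φ, hφ.1, ?_⟩) (hausdorff_le (fun φ hφ => ⟨φ, ⟨hφ, φ, ?_, fun _ => rfl⟩, ?_⟩) fun φ hφ =>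
      ⟨φ, hφ.1, ?_⟩)) zero_le
  · obtain ⟨θ, hθ, h⟩ := hS.exists_state_extension n φ hφ
    exact ⟨θ, (Set.ext_iff.1 (levelSet_one (D := A)) θ).2 hθ, h⟩
  · exact (mongeKantorovich_self _ φ).le
  · exact (mongeKantorovich_self _ φ).le
  · exact (Set.ext_iff.1 (levelSet_one (D := A)) φ).2 hφ
  · exact (mongeKantorovich_self _ φ).le
  · exact (mongeKantorovich_self _ φ).le

theorem basicReach_inclusionBridge_le (hS : IsAFFiltration S τ) (hβ : ∀ n, 0 < β n) (n : ℕ) :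
    (hS.inclusionBridge (I := I) hβ n).basicReach ≤ ENNReal.ofReal (β n) := by
  have h₁ : ∀ a : A, ‖a * 1 - 1 * a‖ₑ ≤ ENNReal.ofReal (β n) := fun a => by
    rw [mul_one, one_mul, sub_self, enorm_zero]
    exact zero_le
  have h₂ : ∀ b : A, Lβ S τ β b ≤ 1 →
      ‖condExp τ (S n) b * 1 - 1 * b‖ₑ ≤ ENNReal.ofReal (β n) := fun b hb => by
    rw [mul_one, one_mul]
    refine enorm_le_ofReal ?_
    rw [norm_sub_rev]
    exact (Lβ_le_one_iff hβ).1 hb n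
  have h₃ : ∀ b : A, star b = b → star (condExp τ (S n) b) = condExp τ (S n) b := fun b hb => by
    rw [← hS.condExp_star, hb]
  refine hausdorff_le ?_ ?_
  · rintro c ⟨⟨a, hsa⟩, ha, rfl⟩
    exact ⟨_, ⟨⟨a.1, congrArg Subtype.val hsa⟩, ha, rfl⟩, h₁ a.1⟩
  · rintro c ⟨⟨b, hsb⟩, hb, rfl⟩
    exact ⟨_, ⟨⟨⟨condExp τ (S n) b, hS.condExp_mem n b⟩, Subtype.ext (h₃ b hsb)⟩,
      hS.Lβ_condExp_le_one hβ hb n, rfl⟩, h₂ b hb⟩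

theorem modularReach_inclusionBridge (hS : IsAFFiltration S τ) (hβ : ∀ n, 0 < β n) (n : ℕ) :
    (hS.inclusionBridge (I := I) hβ n).modularReach = 0 := by
  have h : ∀ x : A, ‖x * 1 - 1 * x‖ₑ ≤ 0 := fun x => by
    rw [mul_one, one_mul, sub_self, enorm_zero]
  refine le_antisymm (iSup_le fun j => iSup_le fun k => max_le ?_ ?_) zero_le
  · exact h (((j.1.1 : S n) : A) * star ((k.1.1 : S n) : A))
  · exact h (((k.1.1 : S n) : A) * star ((j.1.1 : S n) : A))

theorem imprint_inclusionBridge_le (hS : IsAFFiltration S τ) (hβ : ∀ n, 0 < β n) {n : ℕ} {r : ℝ}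
    (h : ∀ ω, DI S τ β I ω ≤ 1 → ∃ η ∈ S n, η ∈ I ∧ DI S τ β I η ≤ 1 ∧
      ∀ ξ, DI S τ β I ξ ≤ 1 → ‖(ω - η) * star ξ‖ ≤ r) :
    (hS.inclusionBridge (I := I) hβ n).imprint ≤ ENNReal.ofReal r := by
  refine max_le (hausdorff_le ?_ fun ω hω => ⟨ω, ⟨⟨ω, hω⟩, rfl⟩, ?_⟩)
    (hausdorff_le ?_ fun ω hω => ?_)
  · rintro _ ⟨j, rfl⟩
    exact ⟨j.1, j.2, (BundleData.modularMK_self _ _).le.trans zero_le⟩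
  · exact (BundleData.modularMK_self _ _).le.trans zero_le
  · rintro _ ⟨j, rfl⟩
    exact ⟨⟨(j.1.1 : A), j.1.2⟩, j.2, (BundleData.modularMK_self _ _).le.trans zero_le⟩
  · obtain ⟨η, hηS, hηI, hη, hle⟩ := h ω.1 hω
    refine ⟨⟨η, hηI⟩, ⟨⟨⟨⟨η, hηS⟩, hηI⟩, hη⟩, rfl⟩, iSup₂_le fun ξ hξ => ?_⟩
    change ‖η * star ξ.1 - ω.1 * star ξ.1‖ₑ ≤ _
    refine enorm_le_ofReal ?_
    rw [norm_sub_rev, ← sub_mul]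
    exact hle ξ.1 hξ

variable [I.IsTwoSided]

theorem modularPropinquity_le (hS : IsAFFiltration S τ) (hβ : ∀ n, 0 < β n)
    (hβ0 : Tendsto β atTop (𝓝 0)) (hI : IsClosed (I : Set A)) {n : ℕ} {r : ℝ} (hr : β n ≤ r)
    (h : ∀ ω, DI S τ β I ω ≤ 1 → ∃ η ∈ S n, η ∈ I ∧ DI S τ β I η ≤ 1 ∧
      ∀ ξ, DI S τ β I ξ ≤ 1 → ‖(ω - η) * star ξ‖ ≤ r) :
    modularPropinquity F₂ G₂ H₂ (finiteIdealBundle S τ β I n) (idealBundle S τ β I)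
      ≤ ENNReal.ofReal r := by
  refine (iInf_le _ (ModularTrek.single
    (hS.isMetrizedQuantumVectorBundle_finiteIdealBundle hβ hβ0 hI n)
    (hS.isMetrizedQuantumVectorBundle_idealBundle hβ hβ0 hI)
    (hS.inclusionBridge hβ n))).trans ?_
  refine max_le ?_ (max_le ?_ ?_)
  · rw [hS.height_inclusionBridge hβ n]
    exact zero_le
  · exact (hS.basicReach_inclusionBridge_le hβ n).trans (ENNReal.ofReal_le_ofReal hr)
  · rw [hS.modularReach_inclusionBridge hβ n, zero_add]
    exact hS.imprint_inclusionBridge_le hβ h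

theorem modularPropinquity_le_max (hS : IsAFFiltration S τ) (hβ : ∀ n, 0 < β n)
    (hβ0 : Tendsto β atTop (𝓝 0)) (hI : IsClosed (I : Set A)) {n : ℕ}
    (h : 1 ≤ β n ∨ ∃ m < n, β m ≤ 1) :
    modularPropinquity F₂ G₂ H₂ (finiteIdealBundle S τ β I n) (idealBundle S τ β I)
      ≤ ENNReal.ofReal (max (β n) (xSeq β n - 1)) := by
  refine hS.modularPropinquity_le hβ hβ0 hI (le_max_left _ _) fun ω hω =>
    hS.exists_norm_sub_mul_star_le_of_bound hβ (le_xSeq_sub_one n)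
      (fun m hm => two_mul_le_xSeq_sub_one_mul hβ hm) ?_ hω
  set y := xSeq β n - 1
  rcases le_or_gt 1 (max (β n) y) with h1 | h1
  · exact Or.inl h1
  · obtain ⟨hb, hy⟩ := max_lt_iff.1 h1
    refine Or.inr ⟨hb, le_max_of_le_right ?_⟩
    obtain ⟨m, hm, hm1⟩ := h.resolve_left (not_le.2 hb)
    have h2 : 2 * β n ≤ y * β m := two_mul_le_xSeq_sub_one_mul hβ hm
    have hb0 := hβ n
    have hy0 : 0 < y := hb0.trans_le (le_xSeq_sub_one n)
    have h3 : 2 * β n ≤ y := h2.trans (mul_le_of_le_one_right hy0.le hm1)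
    have hs : 0 < 1 + y - β n := by linarith
    rw [← le_sub_iff_add_le, div_le_iff₀ hs]
    -- the claim is `b² (1 + y - b) ≤ y (y - b)`, where the left side is at most `2 b²`
    nlinarith [mul_nonneg hb0.le hb0.le, mul_nonneg (sub_nonneg.2 h3) hy0.le,
      mul_nonneg (mul_nonneg hb0.le hb0.le) (by linarith : (0 : ℝ) ≤ 1 - (y - β n)),
      mul_nonneg (sub_nonneg.2 h3) hb0.le]

theorem modularPropinquity_le_max_add_sq (hS : IsAFFiltration S τ) (hβ : ∀ n, 0 < β n)
    (hβ0 : Tendsto β atTop (𝓝 0)) (hI : IsClosed (I : Set A)) (n : ℕ) :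
    modularPropinquity F₂ G₂ H₂ (finiteIdealBundle S τ β I n) (idealBundle S τ β I)
      ≤ ENNReal.ofReal (max (β n) (xSeq β n - 1) + β n ^ 2) := by
  have hsq := sq_nonneg (β n)
  refine hS.modularPropinquity_le hβ hβ0 hI ((le_max_left _ _).trans (le_add_of_nonneg_right hsq))
    fun ω hω => hS.exists_norm_sub_mul_star_le_of_bound hβ (le_xSeq_sub_one n)
      (fun m hm => two_mul_le_xSeq_sub_one_mul hβ hm) ?_ hω
  have hby : β n ≤ xSeq β n - 1 := le_xSeq_sub_one n
  set y := xSeq β n - 1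
  rcases le_or_gt 1 (β n) with h1 | h1
  · exact Or.inl ((h1.trans (le_max_left _ _)).trans (le_add_of_nonneg_right hsq))
  · refine Or.inr ⟨h1, add_le_add_left ((div_le_self ?_ ?_).trans (le_max_right _ _)) _⟩
    · exact (hβ n).le.trans hby
    · linarith

end IsAFFiltration

end Bridge

end ModularPropinquity

theorem mainTheorem2 {A : Type u} [CStarAlgebra A]
    (S : ℕ → StarSubalgebra ℂ A) [∀ n, FiniteDimensional ℂ (S n)]
    (hmono : Monotone S) (hzero : S 0 = ⊥) (hdense : Dense (⋃ n, (S n : Set A)))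
    (τ : WeakDual ℂ A) (hτ : ModularPropinquity.IsFaithfulTracialState τ)
    (β : ℕ → ℝ) (hβ_pos : ∀ n, 0 < β n) (hβ : Tendsto β atTop (𝓝 0))
    (hβ_ratio : Tendsto (fun n => β (n + 1) / β n) atTop (𝓝 0))
    (I : Ideal A) [I.IsTwoSided] (hI : IsClosed (I : Set A)) :
    -- the conditional expectations and the units in the definition of the D-norm exist
    (∀ n, ∃! E : A →ₗ[ℂ] A, ModularPropinquity.IsPreservingCondExp τ (S n) E) ∧
    (∀ n, ∃! e : A, ModularPropinquity.IsIdealUnit I (S n) e) ∧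
    -- the units form an approximate identity of the ideal
    (∀ ω ∈ I,
      Tendsto (fun n => ω * ModularPropinquity.idealUnit I (S n)) atTop (𝓝 ω) ∧
      Tendsto (fun n => ModularPropinquity.idealUnit I (S n) * ω) atTop (𝓝 ω)) ∧
    ModularPropinquity.IsAdmissibleTriple ModularPropinquity.F₂ ModularPropinquity.G₂
      ModularPropinquity.H₂ ∧
    ModularPropinquity.IsMetrizedQuantumVectorBundle ModularPropinquity.F₂
      ModularPropinquity.G₂ ModularPropinquity.H₂ (ModularPropinquity.idealBundle S τ β I) ∧
    (∀ n, ModularPropinquity.IsMetrizedQuantumVectorBundle ModularPropinquity.F₂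
      ModularPropinquity.G₂ ModularPropinquity.H₂
      (ModularPropinquity.finiteIdealBundle S τ β I n)) ∧
    Tendsto (fun n => ModularPropinquity.modularPropinquity ModularPropinquity.F₂
      ModularPropinquity.G₂ ModularPropinquity.H₂
      (ModularPropinquity.finiteIdealBundle S τ β I n)
      (ModularPropinquity.idealBundle S τ β I)) atTop (𝓝 0) ∧
    (∀ n, 1 ≤ n → (1 ≤ β n ∨ ∃ m < n, β m ≤ 1) →
      ModularPropinquity.modularPropinquity ModularPropinquity.F₂
        ModularPropinquity.G₂ ModularPropinquity.H₂
        (ModularPropinquity.finiteIdealBundle S τ β I n)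
        (ModularPropinquity.idealBundle S τ β I) ≤
      ENNReal.ofReal (max (β n) (ModularPropinquity.xSeq β n - 1))) ∧
    (∀ n, 1 ≤ n →
      ModularPropinquity.modularPropinquity ModularPropinquity.F₂
        ModularPropinquity.G₂ ModularPropinquity.H₂
        (ModularPropinquity.finiteIdealBundle S τ β I n)
        (ModularPropinquity.idealBundle S τ β I) ≤
      ENNReal.ofReal (max (β n) (ModularPropinquity.xSeq β n - 1) + β n ^ 2)) ∧
    Tendsto (fun n => max (β n) (ModularPropinquity.xSeq β n - 1)) atTop (𝓝 0) := by
  have hS : ModularPropinquity.IsAFFiltration S τ := ⟨inferInstance, hmono, hzero, hdense, hτ⟩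
  have hlim := ModularPropinquity.tendsto_max_xSeq hβ_pos hβ hβ_ratio
  refine ⟨fun n => ModularPropinquity.existsUnique_isPreservingCondExp hτ (S n),
    fun n => ModularPropinquity.existsUnique_isIdealUnit hτ (S n) I,
    fun ω hω => hS.tendsto_mul_idealUnit I hω, ModularPropinquity.isAdmissibleTriple,
    hS.isMetrizedQuantumVectorBundle_idealBundle hβ_pos hβ hI,
    hS.isMetrizedQuantumVectorBundle_finiteIdealBundle hβ_pos hβ hI, ?_,
    fun n _ h => hS.modularPropinquity_le_max hβ_pos hβ hI h,
    fun n _ => hS.modularPropinquity_le_max_add_sq hβ_pos hβ hI n, hlim⟩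
  have h := ENNReal.tendsto_ofReal (hlim.add (hβ.pow 2))
  simp only [zero_pow two_ne_zero, add_zero, ENNReal.ofReal_zero] at h
  exact tendsto_of_tendsto_of_tendsto_of_le_of_le tendsto_const_nhds h (fun _ => zero_le)
    fun n => hS.modularPropinquity_le_max_add_sq hβ_pos hβ hI n
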